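/- **Setting.** Let $V$ be a separable real Banach space, $(T_r)_{r\ge1}$ natural numbers and $I_r=\{0,\dots,T_r\}$. *Tensor algebras.* Fix an admissible choice of tensor norms: for every real normed space $E$ and $m\ge0$ a norm on $E^{\otimes m}$ such that $\|v\otimes w\|\le\|v\|\,\|w\|$ for all $v\in E^{\otimes m},w\in E^{\otimes n}$, $\|v_1\otimes\cdots\otimes v_m\|\le\prod_i\|v_i\|$, and $|(\ell_1\otimes\cdots\otimes\ell_m)(v)|\le\prod_i\|\ell_i\|\,\|v\|$ for all bounded linear functionals $\ell_i$ on $E$ (for instance the projective or the injective norms). For a normed space $E$, give $\mathbb R\oplus E$ the norm $|a|+\|v\|$ and let $\mathbf T(E)$ be the completion of $\bigoplus_{m\ge0}(\mathbb R\oplus E)^{\otimes m}$ for $\|t\|=\sum_m\|t_m\|$. Put $\mathrm{Ta}_0(V)=V$ and $\mathrm{Ta}_{r+1}(V)=\mathbf T(\mathrm{Ta}_r(V))$. *Signature.* For $x:\{0,\dots,T\}\to E$ let $\Delta_0x=(1,x(0))$, $\Delta_tx=(1,x(t)-x(t-1))$ for $t\ge1$, $\exp v=(v^{\otimes m}/m!)_{m\ge0}$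 and $S(x)=\exp(\Delta_0x)\exp(\Delta_1x)\cdots\exp(\Delta_Tx)\in\mathbf T(E)$. *Tensor normalization.* A tensor normalization on $\mathbf T(E)$ is a map $\Lambda$ that on $\{t:t_0=1\}$ is continuous, injective and bounded, and has the form $\Lambda(t)=(\lambda(t)^mt_m)_{m\ge0}$ with a function $\lambda>0$. *Paths and measures of higher rank.* Put $V_0=\mathrm{Prob}_0(V)=\mathcal M_0(V)=V$ and, for $r\ge1$, $V_r=(I_r\to V_{r-1})$ with the product topology; $\mathrm{Prob}_r(V)$, the Borel probability measures on $I_r\to\mathrm{Prob}_{r-1}(V)$ with the topology of weak convergence; $\mathcal M_r(V)$, the finite signed measures on $I_r\to\mathcal M_{r-1}(V)$, where $V$ carries its Borel $\sigma$-algebra, the spaces of paths the product $\sigma$-algebras, and $\mathcal M_r(V)$ the $\sigma$-algebra generated by the evaluations $\mu\mapsto\mu(A)$, $A$ measurable. *Robust maps.* Given a tensor normalization $\Lambda_{r}$ on $\mathbf T(\mathrm{Ta}_{r-1}(V))=\mathrm{Ta}_r(V)$ for every $r\ge1$, let $\mathrm S_0$ and $\bar{\mathrm S}_0$ be the identity of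 $V$ and, for $r\ge1$, $$\mathrm S_r(x)=\Lambda_r S\big(t\mapsto\mathrm S_{r-1}(x(t))\big),\quad x\in V_r,\qquad \bar{\mathrm S}_r(\mu)=\int\Lambda_r S\big(t\mapsto\bar{\mathrm S}_{r-1}(x(t))\big)\,\mu(dx),$$ for $\mu\in\mathrm{Prob}_r(V)$ and likewise for $\mu\in\mathcal M_r(V)$. **Proposition.** Every $\mathrm{Ta}_r(V)$, $r\ge0$, is a separable Banach space. Families $(\Lambda_r)_{r\ge1}$ of tensor normalizations as above exist. For every such family and every $r\ge1$: 1. the robust signature map $\mathrm S_r:V_r\to\mathrm{Ta}_r(V)$ is bounded, continuous and injective; 2. the integrand in the definition of $\bar{\mathrm S}_r$ is Bochner integrable with respect to every $\mu\in\mathrm{Prob}_r(V)$, and the robust expected signature map $\bar{\mathrm S}_r:\mathrm{Prob}_r(V)\to\mathrm{Ta}_r(V)$ is bounded, continuous and injective; 3. the integrand is also Bochner integrable with respect to (the total variation of) every $\mu\in\mathcal M_r(V)$, the map $\bar{\mathrm S}_r:\mathcal M_r(V)\to\mathrm{Ta}_r(V)$ is injective, and there is a constant $C$ with $\|\bar{\mathrm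 S}_r(\mu)\|\le C\,|\mu|\big(I_r\to\mathcal M_{r-1}(V)\big)$ for all $\mu\in\mathcal M_r(V)$. For $r=0$, where all the spaces are $V$, there is a bounded, continuous and injective map $V\to V$. -/

import Mathlib

universe u v

namespace HRSig

open MeasureTheory PiTensorProduct
open scoped TensorProduct

noncomputable section

/-- An admissible choice of norms on tensor powers: for every real normed space `E` and `m : ℕ`,
a norm on `E ^ ⊗ m` with `‖v ⊗ w‖ ≤ ‖v‖ ‖w‖` for arbitrary tensors, which is a reasonable
cross norm (elementary tensors and products of bounded functionals have norm at most the product of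
the norms).  By Hahn-Banach the last two fields give `‖v₁ ⊗ ⋯ ⊗ vₘ‖ = ‖v₁‖ ⋯ ‖vₘ‖`;
in particular the norm is invariant under permutations of the factors of an elementary tensor, it is
the given norm for `m = 1`, the absolute value for `m = 0`, and it is definite. The projective and
the injective norm are examples. -/
structure AdmissibleNorm : Type (u + 1) where
  seminorm : ∀ (E : Type u) [NormedAddCommGroup E] [NormedSpace ℝ E] (m : ℕ),
    Seminorm ℝ (⨂[ℝ]^m E)
  mul_le : ∀ (E : Type u) [NormedAddCommGroup E] [NormedSpace ℝ E] (m n : ℕ)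
    (v : ⨂[ℝ]^m E) (w : ⨂[ℝ]^n E),
    seminorm E (m + n) (GradedMonoid.GMul.mul (A := fun i => ⨂[ℝ]^i E) v w) ≤
      seminorm E m v * seminorm E n w
  tprod_le : ∀ (E : Type u) [NormedAddCommGroup E] [NormedSpace ℝ E] (m : ℕ) (v : Fin m → E),
    seminorm E m (tprod ℝ v) ≤ ∏ i, ‖v i‖
  dual_le : ∀ (E : Type u) [NormedAddCommGroup E] [NormedSpace ℝ E] (m : ℕ)
    (l : Fin m → (E →L[ℝ] ℝ)) (v : ⨂[ℝ]^m E),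
    |lift ((MultilinearMap.mkPiAlgebra ℝ (Fin m) ℝ).compLinearMap
        (fun i => (l i).toLinearMap)) v| ≤ (∏ i, ‖l i‖) * seminorm E m v

section Projective

theorem projective_mul_le_aux (E : Type u) [NormedAddCommGroup E] [NormedSpace ℝ E] (m n : ℕ)
    (v : Fin m → E) (w : Fin n → E) :
   ‖(GradedMonoid.GMul.mul (A := fun i => ⨂[ℝ]^i E) (tprod ℝ v) (tprod ℝ w))‖ ≤ (∏ i, ‖v i‖) * ∏ i, ‖w i‖ := by
  rw [TensorPower.tprod_mul_tprod]
  refine (projectiveSeminorm_tprod_le _).trans (le_of_eq ?_)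
  rw [Fin.prod_univ_add]; simp

theorem projective_bound_aux (E : Type u) [NormedAddCommGroup E] [NormedSpace ℝ E] {m : ℕ}
    {G : Type v} [SeminormedAddCommGroup G] [NormedSpace ℝ G] (f : (⨂[ℝ]^m E) →ₗ[ℝ] G) (C : ℝ)
    (hC : 0 ≤ C) (h : ∀ v, ‖f (tprod ℝ v)‖ ≤ C * ∏ i, ‖v i‖) (x) : ‖f x‖ ≤ C * ‖x‖ := by
  let g := (f.compMultilinearMap (tprod ℝ)).mkContinuous C h
  have h1 := norm_eval_le_projectiveSeminorm (f := g) x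
  have : lift g.toMultilinearMap = f := by
    ext v; simp only [LinearMap.compMultilinearMap_apply, lift.tprod]; rfl
  rw [this] at h1
  exact h1.trans (mul_le_mul_of_nonneg_right (MultilinearMap.mkContinuous_norm_le _ hC _) (norm_nonneg _))

/-- The projective tensor norm is admissible. -/
def projectiveNorm : AdmissibleNorm.{u} where
  seminorm E _ _ m := projectiveSeminorm
  mul_le E _ _ m n v w := by
    rw [mul_comm]
    let B : (⨂[ℝ]^m E) →ₗ[ℝ] (⨂[ℝ]^n E) →ₗ[ℝ] (⨂[ℝ]^(m + n) E) :=
      ((TensorProduct.mk ℝ _ _).compr₂ ↑(TensorPower.mulEquiv : _ ≃ₗ[ℝ] (⨂[ℝ]^(m + n)) E))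
    refine projective_bound_aux E (B.flip w) ‖w‖ (norm_nonneg _) (fun v => ?_) v
    rw [mul_comm]
    refine projective_bound_aux E (B (tprod ℝ v)) _ (by positivity) (fun w => ?_) w
    exact projective_mul_le_aux E m n v w
  tprod_le E _ _ m v := projectiveSeminorm_tprod_le v
  dual_le E _ _ m l v := by
    refine projective_bound_aux E (lift ((MultilinearMap.mkPiAlgebra ℝ (Fin m) ℝ).compLinearMap
        (fun i => (l i).toLinearMap))) _ (by positivity) (fun v => ?_) v
    simp only [lift.tprod, MultilinearMap.compLinearMap_apply, MultilinearMap.mkPiAlgebra_apply]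
    rw [norm_prod, ← Finset.prod_mul_distrib]
    exact Finset.prod_le_prod (fun _ _ => norm_nonneg _) (fun i _ => (l i).le_opNorm _)

end Projective

/-- The algebraic tensor power `E ^ ⊗ m` with the chosen norm. -/
def TPow (_α : AdmissibleNorm.{u}) (E : Type u) [NormedAddCommGroup E] [NormedSpace ℝ E]
    (m : ℕ) : Type u := ⨂[ℝ]^m E

section TA

variable (α : AdmissibleNorm.{u}) (E : Type u) [NormedAddCommGroup E] [NormedSpace ℝ E]

instance (m : ℕ) : SeminormedAddCommGroup (TPow α E m) :=
  @AddGroupSeminorm.toSeminormedAddCommGroup (⨂[ℝ]^m E) _ (α.seminorm E m).toAddGroupSeminorm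

instance (m : ℕ) : NormedSpace ℝ (TPow α E m) where
  toModule := inferInstanceAs (Module ℝ (⨂[ℝ]^m E))
  norm_smul_le a b := (map_smul_eq_mul (α.seminorm E m) a b).le

/-- The inclusion of the algebraic tensor power into its completion. -/
def toCompletion (m : ℕ) (a : ⨂[ℝ]^m E) : UniformSpace.Completion (TPow α E m) :=
  UniformSpace.Completion.coe' (α := TPow α E m) a

theorem norm_toCompletion (m : ℕ) (a : ⨂[ℝ]^m E) :
    ‖toCompletion α E m a‖ = α.seminorm E m a :=
  UniformSpace.Completion.norm_coe (E := TPow α E m) a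

/-- `ℝ ⊕ E`, the first coordinate being time, with the norm `|a| + ‖v‖`. -/
abbrev TimeExt : Type u := WithLp 1 (ℝ × E)

/-- The tensor algebra over `ℝ ⊕ E`, completed for the norm `‖t‖ = ∑ₘ ‖tₘ‖`: sequences `(tₘ)` with
`tₘ` in the completion of `(ℝ ⊕ E) ^ ⊗ m` and `∑ₘ ‖tₘ‖ < ∞`. This is the completion of
`⨁ₘ (ℝ ⊕ E) ^ ⊗ m`, which sits in it as a dense subspace. -/
abbrev TA : Type u := lp (fun m : ℕ => UniformSpace.Completion (TPow α (TimeExt E) m)) 1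

end TA

section Series

variable {E : Type u} [NormedAddCommGroup E] [NormedSpace ℝ E]

/-- The unit `(1, 0, 0, …)` of `∏ₘ E ^ ⊗ m`. -/
def tone : ∀ m : ℕ, ⨂[ℝ]^m E
  | 0 => tprod ℝ (fun _ => 0)
  | _ + 1 => 0

/-- The tensor convolution product on `∏ₘ E ^ ⊗ m`, `(s t)ₘ = ∑_{i ≤ m} sᵢ ⊗ tₘ₋ᵢ`. -/
def tconv (s t : ∀ m : ℕ, ⨂[ℝ]^m E) (m : ℕ) : ⨂[ℝ]^m E :=
  ∑ i : Fin (m + 1), TensorPower.cast ℝ E (Nat.add_sub_cancel' (Nat.lt_succ_iff.mp i.2))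
    (GradedMonoid.GMul.mul (A := fun i => ⨂[ℝ]^i E) (s i) (t (m - i)))

/-- The tensor exponential `v ↦ (v ^ ⊗ m / m!)ₘ`. -/
def texp (v : E) (m : ℕ) : ⨂[ℝ]^m E := ((m.factorial : ℝ)⁻¹) • tprod ℝ (fun _ : Fin m => v)

/-- The time-extended increments of a path indexed by `{0, …, T}`:
`Δ₀ x = (1, x 0)` and `Δₜ x = (1, x t - x (t - 1))` for `t ≥ 1`. -/
def incr {T : ℕ} (x : Fin (T + 1) → E) : Fin (T + 1) → TimeExt E :=
  Fin.cases (WithLp.toLp 1 (1, x 0)) (fun t : Fin T => WithLp.toLp 1 (1, x t.succ - x t.castSucc))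

/-- The signature as an element of `∏ₘ (ℝ ⊕ E) ^ ⊗ m`: the ordered product
`exp (Δ₀ x) · exp (Δ₁ x) ⋯ exp (Δ_T x)`. -/
def sigSeries {T : ℕ} (x : Fin (T + 1) → E) : ∀ m : ℕ, ⨂[ℝ]^m (TimeExt E) :=
  (List.ofFn (incr x)).foldr (fun v s => tconv (texp v) s) tone

variable (α : AdmissibleNorm.{u})

/-- The series converges absolutely. -/
def AbsSummable (s : ∀ m : ℕ, ⨂[ℝ]^m E) : Prop := Summable fun m => α.seminorm E m (s m)


end Series
section Summability

theorem seminorm_cast {E : Type u} [NormedAddCommGroup E] [NormedSpace ℝ E]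
    (α : AdmissibleNorm.{u}) {i j : ℕ} (h : i = j) (a : ⨂[ℝ]^i E) :
    α.seminorm E j (TensorPower.cast ℝ E h a) = α.seminorm E i a := by
  subst h
  simp [TensorPower.cast_refl]

theorem AbsSummable.tconv {E : Type u} [NormedAddCommGroup E] [NormedSpace ℝ E]
    {α : AdmissibleNorm.{u}} {s t : ∀ m : ℕ, ⨂[ℝ]^m E}
    (hs : AbsSummable α s) (ht : AbsSummable α t) : AbsSummable α (tconv s t) := by
  have h := summable_norm_sum_mul_range_of_summable_norm
    (f := fun m => α.seminorm E m (s m)) (g := fun m => α.seminorm E m (t m)) hs.norm ht.norm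
  refine Summable.of_nonneg_of_le (fun m => apply_nonneg _ _) (fun m => ?_) h
  refine le_trans ?_ (le_abs_self _)
  rw [Finset.sum_range]
  refine (Finset.le_sum_of_subadditive (α.seminorm E m) (map_zero (α.seminorm E m)).le
    (map_add_le_add _) _ _).trans (Finset.sum_le_sum fun i _ => ?_)
  rw [seminorm_cast]
  exact α.mul_le E _ _ _ _

theorem AbsSummable.tone {E : Type u} [NormedAddCommGroup E] [NormedSpace ℝ E]
    (α : AdmissibleNorm.{u}) : AbsSummable α (tone (E := E)) := by
  refine summable_of_ne_finset_zero (s := {0}) (fun m hm => ?_)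
  cases m with
  | zero => simp at hm
  | succ n => exact map_zero (α.seminorm E (n + 1))

theorem AbsSummable.texp {E : Type u} [NormedAddCommGroup E] [NormedSpace ℝ E]
    (α : AdmissibleNorm.{u}) (v : E) : AbsSummable α (texp v) := by
  refine Summable.of_nonneg_of_le (fun m => apply_nonneg _ _) (fun m => ?_)
    (Real.summable_pow_div_factorial ‖v‖)
  have h := α.tprod_le E m (fun _ => v)
  rw [Finset.prod_const, Finset.card_fin] at h
  have h2 : α.seminorm E m (HRSig.texp v m) =
      (m.factorial : ℝ)⁻¹ * α.seminorm E m (tprod ℝ (fun _ : Fin m => v)) := by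
    rw [HRSig.texp, map_smul_eq_mul, Real.norm_of_nonneg (by positivity)]
  rw [h2, div_eq_inv_mul]
  exact mul_le_mul_of_nonneg_left h (by positivity)

theorem absSummable_sigSeries {E : Type u} [NormedAddCommGroup E] [NormedSpace ℝ E]
    (α : AdmissibleNorm.{u}) {T : ℕ} (x : Fin (T + 1) → E) : AbsSummable α (sigSeries x) := by
  unfold sigSeries
  induction List.ofFn (incr x) with
  | nil => exact AbsSummable.tone α
  | cons v l ih => exact (AbsSummable.texp α v).tconv ih

end Summability

section Signature

variable (α : AdmissibleNorm.{u}) {E : Type u} [NormedAddCommGroup E] [NormedSpace ℝ E]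

/-- The (rank one) signature `(I → E) → T(ℝ ⊕ E)` of a path indexed by `I = {0, …, T}`. -/
def sig {T : ℕ} (x : Fin (T + 1) → E) : TA α E :=
  ⟨fun m => toCompletion α _ m (sigSeries x m), by
    refine memℓp_gen ?_
    simp only [norm_toCompletion, ENNReal.toReal_one, Real.rpow_one]
    exact absSummable_sigSeries α x⟩

/-- The elements `t` of the tensor algebra with `t₀ = 1`. -/
def unitLevel (E : Type u) [NormedAddCommGroup E] [NormedSpace ℝ E] : Set (TA α E) :=
  {t | t 0 = toCompletion α _ 0 (tone 0)}

/-- `Λ` is a tensor normalization: on `{t | t₀ = 1}` it is a continuous injective map with values in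
a ball, of the form `t ↦ δ_{λ(t)} t = (λ(t) ^ m tₘ)ₘ` with a function `λ > 0`.
(Its values elsewhere are irrelevant.) -/
def IsTensorNormalization (Λ : TA α E → TA α E) : Prop :=
  (∃ lam : TA α E → ℝ, ∀ t ∈ unitLevel α E, 0 < lam t ∧ ∀ m : ℕ, Λ t m = lam t ^ m • t m) ∧
  (∃ K : ℝ, ∀ t ∈ unitLevel α E, ‖Λ t‖ ≤ K) ∧
  ContinuousOn Λ (unitLevel α E) ∧
  Set.InjOn Λ (unitLevel α E)

end Signature

/-- A bundled real normed space, used to iterate the tensor algebra construction. -/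
structure NormedSp : Type (u + 1) where
  carrier : Type u
  [group : NormedAddCommGroup carrier]
  [space : NormedSpace ℝ carrier]

attribute [instance] NormedSp.group NormedSp.space

/-- `T₀(V) = V` and `Tᵣ₊₁(V) = T(ℝ ⊕ Tᵣ(V))`. -/
def taTower (α : AdmissibleNorm.{u}) (V : Type u) [NormedAddCommGroup V] [NormedSpace ℝ V] :
    ℕ → NormedSp.{u}
  | 0 => ⟨V⟩
  | r + 1 => ⟨TA α (taTower α V r).carrier⟩

/-- The rank `r` tensor algebra of `V`. -/
abbrev Ta (α : AdmissibleNorm.{u}) (V : Type u) [NormedAddCommGroup V] [NormedSpace ℝ V] (r : ℕ) :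
    Type u := (taTower α V r).carrier

section Domains

variable (T : ℕ → ℕ)

/-- Paths of rank `r` with values in `V`; the `(r + 1)`-st time set is `{0, …, T r}`. -/
def PathSp (V : Type u) : ℕ → Type u
  | 0 => V
  | r + 1 => Fin (T r + 1) → PathSp V r

instance pathSpTopology (V : Type u) [TopologicalSpace V] :
    ∀ r, TopologicalSpace (PathSp T V r)
  | 0 => inferInstanceAs (TopologicalSpace V)
  | r + 1 =>
    letI := pathSpTopology V r
    inferInstanceAs (TopologicalSpace (Fin (T r + 1) → PathSp T V r))

/-- Borel probability measures on a topological space. -/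
def BorelProb (X : Type u) [TopologicalSpace X] : Type u := @ProbabilityMeasure X (borel X)

/-- The underlying Borel measure. -/
def BorelProb.toMeasure {X : Type u} [TopologicalSpace X] (μ : BorelProb X) :
    @Measure X (borel X) := μ.1

/-- The topology of weak convergence. -/
instance (X : Type u) [TopologicalSpace X] : TopologicalSpace (BorelProb X) :=
  @ProbabilityMeasure.instTopologicalSpace X (borel X) _
    (@BorelSpace.opensMeasurable X _ (borel X) (@BorelSpace.mk X _ (borel X) rfl))

/-- `Prob₀(V) = V` and `Probᵣ₊₁(V) = Prob(I → Probᵣ(V))`, with the weak topologies. -/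
def probTower (V : Type u) [TopologicalSpace V] : ℕ → TopCat.{u}
  | 0 => TopCat.of V
  | r + 1 => TopCat.of (BorelProb (Fin (T r + 1) → probTower V r))

/-- Rank `r` probability measures on `V`. -/
abbrev ProbSp (V : Type u) [TopologicalSpace V] (r : ℕ) : Type u := (probTower T V r : Type u)

/-- The `σ`-algebra on the space of finite signed measures that is generated by the evaluations
`μ ↦ μ(A)`, `A` measurable. -/
instance signedMeasurableSpace (X : Type u) [MeasurableSpace X] :
    MeasurableSpace (SignedMeasure X) :=
  ⨆ (A : Set X) (_ : MeasurableSet A), (borel ℝ).comap fun μ : SignedMeasure X => μ A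

/-- `M₀(V) = V` and `Mᵣ₊₁(V) = M(I → Mᵣ(V))`, where `M` denotes finite signed measures. -/
def measTower (V : Type u) [TopologicalSpace V] : ℕ → MeasCat.{u}
  | 0 => @MeasCat.of V (borel V)
  | r + 1 => MeasCat.of (SignedMeasure (Fin (T r + 1) → measTower V r))

/-- Rank `r` (finite signed) measures on `V`. -/
abbrev MeasSp (V : Type u) [TopologicalSpace V] (r : ℕ) : Type u := (measTower T V r : Type u)

end Domains

/-- The Bochner integral with respect to a finite signed measure, `∫ f dμ⁺ - ∫ f dμ⁻`. -/
def signedIntegral {X : Type u} [MeasurableSpace X] {F : Type v} [NormedAddCommGroup F]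
    [NormedSpace ℝ F] (μ : SignedMeasure X) (f : X → F) : F :=
  ∫ x, f x ∂μ.toJordanDecomposition.posPart - ∫ x, f x ∂μ.toJordanDecomposition.negPart

section Robust

variable {α : AdmissibleNorm.{u}} {V : Type u} [NormedAddCommGroup V] [NormedSpace ℝ V]
variable (Λ : ∀ r, TA α (Ta α V r) → TA α (Ta α V r)) (T : ℕ → ℕ)

/-- The robust signature `x ↦ Λ(S(g ∘ x))` of a path that is first mapped to `Tᵣ(V)` by `g`. -/
def liftSig {X : Type u} {r n : ℕ} (g : X → Ta α V r) (x : Fin (n + 1) → X) : Ta α V (r + 1) :=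
  Λ r (sig α (fun t => g (x t)))

/-- The robust signature map of rank `r`, which is the identity for `r = 0`. -/
def robustSig : ∀ r, PathSp T V r → Ta α V r
  | 0 => fun x => x
  | r + 1 => fun x => liftSig Λ (robustSig r) x

/-- The robust expected signature map of rank `r` on rank `r` probability measures, which is the
identity for `r = 0`. -/
def robustESig : ∀ r, ProbSp T V r → Ta α V r
  | 0 => fun x => x
  | r + 1 => fun μ =>
    @integral _ _ _ _ (borel _) (BorelProb.toMeasure μ) (liftSig Λ (robustESig r))

/-- The robust expected signature map of rank `r` on rank `r` signed measures, which is the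
identity for `r = 0`. -/
def robustESigM : ∀ r, MeasSp T V r → Ta α V r
  | 0 => fun x => x
  | r + 1 => fun μ => signedIntegral μ (liftSig Λ (robustESigM r))

end Robust

end

end HRSig

open HRSig

/-! The signature is a product of exponentials of increments whose time component is `1`. Read on
words of functionals, it is multiplicative for the shuffle product (`isShuffleCharacter_expProd`):
convolution with the exponential of `t v` preserves this property, because both sides of the shuffle
identity have the same derivative in `t`. A normalization scales level `m` by `λ ^ m`, and all
shuffles of two words have the same length, so the identity survives. Hence the word coordinates of
`Λ ∘ S` span a unital algebra of bounded continuous functions of the path. This algebra separates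
paths: the time letter reveals `λ`, and words made of one functional followed by time letters reveal
the increments (`IsTensorNormalization.eq_of_forall_wordCLM_eq`). The claims on the robust signature
follow by induction on the rank.

For the expected signatures, injectivity alone does not pass to the next rank. The induction carries
a measurable form of it (`ESigGenerates`, `ESigMGenerates`): the map is continuous, respectively
measurable, and its pulled-back `σ`-algebra contains the given one. At one rank, integrals of
elements of the algebra are bounded linear functionals of the expected signature. On the Polish
space of paths in a separable Banach space the algebra generates the Borel sets, so a monotone class
argument makes every `μ(B)` a measurable function of the expected signature
(`IsTensorNormalization.measurable_real_sub_real`). This gives injectivity. It also gives the next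
step of the induction, since evaluations generate the `σ`-algebra on measures: by definition for
signed measures, and by a countable subbasis of the weak topology for probability measures.
Continuity holds because weak convergence also controls bounded continuous integrands with values in
a separable Banach space.

Normalizations exist: dilate `t` by the root `c` of `c + ∑_{m ≥ 1} c ^ m ‖tₘ‖ = 1`. -/

namespace HRSig

open MeasureTheory Filter Topology
open scoped TensorProduct

/-! ### Algebras of bounded functions and the `σ`-algebras they generate. -/

section MonotoneClass

variable {X : Type*} (𝒜 : Subalgebra ℝ (X → ℝ))

/-- The sets `{a > 0}` for `a` in an algebra of functions. -/
def posSets : Set (Set X) := {s | ∃ a ∈ 𝒜, s = {x | 0 < a x}}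

/-- The indicator of `s` is a bounded pointwise limit of functions in the algebra. -/
def IsBddLimit (s : Set X) : Prop :=
  ∃ (b : ℕ → X → ℝ) (C : ℝ), (∀ n, b n ∈ 𝒜) ∧ (∀ n x, ‖b n x‖ ≤ C) ∧
    ∀ x, Tendsto (fun n => b n x) atTop (𝓝 (s.indicator (fun _ => (1 : ℝ)) x))

variable {𝒜}

theorem IsBddLimit.inter {s t : Set X} (hs : IsBddLimit 𝒜 s) (ht : IsBddLimit 𝒜 t) :
    IsBddLimit 𝒜 (s ∩ t) := by
  obtain ⟨b, C, hb, hC, hl⟩ := hs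
  obtain ⟨b', C', hb', hC', hl'⟩ := ht
  refine ⟨fun n => b n * b' n, C * C', fun n => 𝒜.mul_mem (hb n) (hb' n), fun n x => ?_,
    fun x => ?_⟩
  · change ‖b n x * b' n x‖ ≤ _
    rw [norm_mul]
    exact mul_le_mul (hC n x) (hC' n x) (norm_nonneg _) ((norm_nonneg _).trans (hC n x))
  · have := (hl x).mul (hl' x)
    rwa [← Set.inter_indicator_mul, show (fun _ : X => (1 : ℝ) * 1) = fun _ => 1 by simp] at this

theorem IsBddLimit.univ : IsBddLimit 𝒜 Set.univ :=
  ⟨fun _ => 1, 1, fun _ => 𝒜.one_mem, fun _ _ => by simp, fun _ => by simp⟩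

theorem tendsto_min_one_mul_max (x : ℝ) :
    Tendsto (fun n : ℕ => min 1 (n * max x 0)) atTop
      (𝓝 ((Set.Ioi (0 : ℝ)).indicator (fun _ => (1 : ℝ)) x)) := by
  by_cases hx : 0 < x
  · rw [Set.indicator_of_mem (by exact hx)]
    refine tendsto_const_nhds.congr' ?_
    filter_upwards [(tendsto_natCast_atTop_atTop.atTop_mul_const hx).eventually_ge_atTop
      (1 : ℝ)] with n hn
    rw [max_eq_left hx.le, min_eq_left hn]
  · rw [Set.indicator_of_notMem (by simpa using hx), max_eq_right (not_lt.mp hx)]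
    simp

theorem IsBddLimit.pos {a : X → ℝ} (ha : a ∈ 𝒜) (hbdd : ∃ C, ∀ x, ‖a x‖ ≤ C) :
    IsBddLimit 𝒜 {x | 0 < a x} := by
  obtain ⟨C, hC⟩ := hbdd
  -- Weierstrass: the algebra contains polynomials in `a` but not truncations, so the ramps `min 1
  -- (n * max x 0)`, which increase to the indicator of the positive half-line, are replaced by
  -- polynomials within `1 / (n + 1)` on the range of `a`. The ramps are at most `1` and the error
  -- is at most `1`, hence the bound `2`.
  have hp : ∀ n : ℕ, ∃ p : Polynomial ℝ, ∀ x ∈ Set.Icc (-C) C,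
      |p.eval x - min 1 (n * max x 0)| < 1 / ((n : ℝ) + 1) := fun n =>
    exists_polynomial_near_of_continuousOn (-C) C _ (by fun_prop) _ (by positivity)
  choose p hp using hp
  have hmem : ∀ x, a x ∈ Set.Icc (-C) C := fun x => abs_le.mp (hC x)
  have heq : ∀ n x, (Polynomial.aeval a (p n)) x = (p n).eval (a x) := fun n x => by
    simp
  refine ⟨fun n => Polynomial.aeval a (p n), 2, fun n => ?_, fun n x => ?_, fun x => ?_⟩
  · exact Algebra.adjoin_le (Set.singleton_subset_iff.mpr ha)
      (Polynomial.aeval_mem_adjoin_singleton ℝ a)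
  · change ‖Polynomial.aeval a (p n) x‖ ≤ 2
    rw [heq]
    have h1 := (hp n _ (hmem x)).le
    have h2 : 1 / ((n : ℝ) + 1) ≤ 1 := by
      rw [div_le_one (by positivity)]; linarith [(Nat.cast_nonneg n : (0 : ℝ) ≤ n)]
    have h3 : |min 1 ((n : ℝ) * max (a x) 0)| ≤ 1 := by
      rw [abs_of_nonneg (by positivity)]; exact min_le_left _ _
    calc ‖(p n).eval (a x)‖ = ‖((p n).eval (a x) - min 1 (n * max (a x) 0))
          + min 1 (n * max (a x) 0)‖ := by ring_nf
      _ ≤ 1 + 1 := (norm_add_le _ _).trans (add_le_add (h1.trans h2) h3)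
      _ = 2 := by norm_num
  · simp only [heq]
    have h0 : Tendsto (fun n => (p n).eval (a x) - min 1 (n * max (a x) 0)) atTop (𝓝 0) :=
      squeeze_zero_norm (fun n => (hp n _ (hmem x)).le) tendsto_one_div_add_atTop_nhds_zero_nat
    have := h0.add (tendsto_min_one_mul_max (a x))
    simp only [sub_add_cancel, zero_add] at this
    exact this

/-- Integrals of an algebra of bounded functions determine the evaluations of finite signed
measures on the generated `σ`-algebra, measurably. -/
theorem measurable_real_sub_real_of_integral [MeasurableSpace X]
    (hmeas : ∀ a ∈ 𝒜, Measurable a) (hbdd : ∀ a ∈ 𝒜, ∃ C, ∀ x, ‖a x‖ ≤ C)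
    {Y : Type*} [MeasurableSpace Y] (p q : Y → Measure X) [∀ y, IsFiniteMeasure (p y)]
    [∀ y, IsFiniteMeasure (q y)]
    (h : ∀ a ∈ 𝒜, Measurable fun y => ∫ x, a x ∂(p y) - ∫ x, a x ∂(q y))
    {B : Set X} (hB : MeasurableSet[MeasurableSpace.generateFrom (posSets 𝒜)] B) :
    Measurable fun y => (p y).real B - (q y).real B := by
  have hlim : ∀ s, IsBddLimit 𝒜 s → MeasurableSet s := by
    rintro s ⟨b, C, hb, -, hl⟩
    refine (measurable_indicator_const_iff (1 : ℝ)).mp ?_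
    exact measurable_of_tendsto_metrizable (fun n => hmeas _ (hb n)) (tendsto_pi_nhds.mpr hl)
  have hle : MeasurableSpace.generateFrom {s | IsBddLimit 𝒜 s} ≤ ‹MeasurableSpace X› :=
    MeasurableSpace.generateFrom_le hlim
  have hle' : MeasurableSpace.generateFrom (posSets 𝒜) ≤
      MeasurableSpace.generateFrom {s | IsBddLimit 𝒜 s} := by
    refine MeasurableSpace.generateFrom_mono ?_
    rintro s ⟨a, ha, rfl⟩
    exact IsBddLimit.pos ha (hbdd a ha)
  have hbasic : ∀ s, IsBddLimit 𝒜 s → Measurable fun y => (p y).real s - (q y).real s := by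
    intro s hs
    have hsm := hlim s hs
    obtain ⟨b, C, hb, hC, hl⟩ := hs
    refine measurable_of_tendsto_metrizable (fun n => h _ (hb n)) (tendsto_pi_nhds.mpr fun y => ?_)
    have key : ∀ (m : Measure X) [IsFiniteMeasure m],
        Tendsto (fun n => ∫ x, b n x ∂m) atTop (𝓝 (m.real s)) := by
      intro m _
      rw [← mul_one (m.real s), ← smul_eq_mul, ← integral_indicator_const (1 : ℝ) hsm]
      exact tendsto_integral_of_dominated_convergence (fun _ => C)
        (fun n => (hmeas _ (hb n)).aestronglyMeasurable) (integrable_const _)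
        (fun n => Eventually.of_forall (hC n)) (Eventually.of_forall hl)
    exact (key (p y)).sub (key (q y))
  -- The sets whose indicators are bounded limits form a π-system, as products of limits are limits.
  -- Dominated convergence settles them; complements and disjoint unions follow from finiteness and
  -- countable additivity.
  refine MeasurableSpace.induction_on_inter
    (C := fun s _ => Measurable fun y => (p y).real s - (q y).real s)
    (m := MeasurableSpace.generateFrom {s | IsBddLimit 𝒜 s}) rfl
    (fun s hs t ht _ => IsBddLimit.inter hs ht) ?_ (fun s hs => hbasic s hs) ?_ ?_ B (hle' B hB)
  · simp
  · intro t ht ih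
    have := (hbasic _ IsBddLimit.univ).sub ih
    convert this using 1
    funext y
    rw [measureReal_compl (hle t ht), measureReal_compl (hle t ht), Pi.sub_apply]
    ring
  · intro f hd hf ih
    have : ∀ y, HasSum (fun i => (p y).real (f i) - (q y).real (f i))
        ((p y).real (⋃ i, f i) - (q y).real (⋃ i, f i)) := by
      intro y
      have key : ∀ (m : Measure X) [IsFiniteMeasure m],
          HasSum (fun i => m.real (f i)) (m.real (⋃ i, f i)) := by
        intro m _
        have h1 := measure_iUnion (μ := m) hd (fun i => hle _ (hf i))
        have h2 : ∑' i, m (f i) ≠ ⊤ := h1 ▸ measure_ne_top m _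
        simp only [measureReal_def, h1]
        rw [ENNReal.tsum_toReal_eq (fun i => measure_ne_top m _)]
        exact (ENNReal.summable_toReal h2).hasSum
      exact (key (p y)).sub (key (q y))
    refine measurable_of_tendsto_metrizable
      (f := fun n y => ∑ i ∈ Finset.range n, ((p y).real (f i) - (q y).real (f i)))
      (fun n => Finset.measurable_sum _ (fun i _ => ih i))
      (tendsto_pi_nhds.mpr fun y => (this y).tendsto_sum_nat)

/-- On a Polish space a point separating algebra of continuous functions generates the Borel
`σ`-algebra. -/
theorem borel_le_generateFrom_posSets [TopologicalSpace X] [PolishSpace X]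
    (hcont : ∀ a ∈ 𝒜, Continuous a) (hsep : ∀ x y, x ≠ y → ∃ a ∈ 𝒜, a x ≠ a y) :
    borel X ≤ MeasurableSpace.generateFrom (posSets 𝒜) := by
  let : MeasurableSpace X := borel X
  have : BorelSpace X := ⟨rfl⟩
  -- The sets where some `a` distinguishes two points cover the complement of the diagonal. By the
  -- Lindelöf property of `X × X`, countably many functions suffice to separate points.
  obtain ⟨c, hc, hcU⟩ := TopologicalSpace.isOpen_iUnion_countable
    (fun a : 𝒜 => {z : X × X | (a : X → ℝ) z.1 ≠ (a : X → ℝ) z.2})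
    (fun a => isOpen_ne_fun ((hcont _ a.2).comp continuous_fst) ((hcont _ a.2).comp continuous_snd))
  have : Countable c := hc.to_subtype
  let φ : X → (c → ℝ) := fun x a => (a.1 : X → ℝ) x
  have hφc : Continuous φ := continuous_pi fun a => hcont _ a.1.2
  have hφi : Function.Injective φ := by
    intro x y hxy
    by_contra hne
    obtain ⟨a, ha, hxa⟩ := hsep x y hne
    have : (x, y) ∈ ⋃ a : 𝒜, {z : X × X | (a : X → ℝ) z.1 ≠ (a : X → ℝ) z.2} :=
      Set.mem_iUnion.mpr ⟨⟨a, ha⟩, hxa⟩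
    rw [← hcU] at this
    simp only [Set.mem_iUnion] at this
    obtain ⟨b, hb, hxb⟩ := this
    exact hxb (congrFun hxy ⟨b, hb⟩)
  -- Lusin–Souslin: a continuous injection of a Polish space into `ℝ ^ c`, with `c` countable, maps
  -- Borel sets to Borel sets.
  have hφ : MeasurableEmbedding φ := hφc.measurableEmbedding hφi
  intro B hB
  have hB' : MeasurableSet (φ '' B) := hφ.measurableSet_image.mpr hB
  rw [← hφi.preimage_image B]
  refine (@measurable_pi_iff X c _ (MeasurableSpace.generateFrom (posSets 𝒜)) _ φ).mpr
    (fun a => ?_) hB'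
  let : MeasurableSpace X := MeasurableSpace.generateFrom (posSets 𝒜)
  refine measurable_of_Ioi fun t => ?_
  -- The algebra contains constants, so `{a > t} = {a - t > 0}`.
  refine MeasurableSpace.measurableSet_generateFrom
    ⟨(a.1 : X → ℝ) - algebraMap ℝ (X → ℝ) t, 𝒜.sub_mem a.1.2 (𝒜.algebraMap_mem t), ?_⟩
  ext x
  simp [φ]

end MonotoneClass

/-! ### Integration against finite signed measures. -/

section SignedIntegral

variable {X : Type u} [MeasurableSpace X]

theorem measurable_signedMeasure_apply {A : Set X} (hA : MeasurableSet A) :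
    Measurable fun μ : SignedMeasure X => μ A := by
  intro s hs
  have h : (borel ℝ).comap (fun μ : SignedMeasure X => μ A) ≤ signedMeasurableSpace X :=
    le_iSup₂ (f := fun (A : Set X) (_ : MeasurableSet A) =>
      (borel ℝ).comap fun μ : SignedMeasure X => μ A) A hA
  exact h _ ⟨s, by rwa [← BorelSpace.measurable_eq (α := ℝ)], rfl⟩

theorem integrable_of_stronglyMeasurable_bdd {F : Type*} [NormedAddCommGroup F]
    {f : X → F} (hf : StronglyMeasurable f) {C : ℝ}
    (hC : ∀ x, ‖f x‖ ≤ C) (m : Measure X) [IsFiniteMeasure m] : Integrable f m :=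
  Integrable.of_bound hf.aestronglyMeasurable C (Eventually.of_forall hC)

variable {F : Type v} [NormedAddCommGroup F] [NormedSpace ℝ F]

theorem norm_signedIntegral_le {f : X → F} {C : ℝ} (hC : ∀ x, ‖f x‖ ≤ C) (μ : SignedMeasure X) :
    ‖signedIntegral μ f‖ ≤ C * μ.totalVariation.real Set.univ := by
  rw [SignedMeasure.totalVariation, measureReal_add_apply, mul_add]
  exact (norm_sub_le _ _).trans (add_le_add (norm_integral_le_of_norm_le_const
    (Eventually.of_forall hC)) (norm_integral_le_of_norm_le_const (Eventually.of_forall hC)))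

/-- Integration of a bounded measurable function with values in a separable Banach space is a
measurable map on the space of finite signed measures. -/
theorem measurable_signedIntegral [MeasurableSpace F] [BorelSpace F] {f : X → F}
    (hf : StronglyMeasurable f) {C : ℝ} (hC : ∀ x, ‖f x‖ ≤ C) [SecondCountableTopology F]
    [CompleteSpace F] : Measurable fun μ : SignedMeasure X => signedIntegral μ f := by
  cases isEmpty_or_nonempty X
  · simp [signedIntegral, Measure.eq_zero_of_isEmpty]
  have hC0 : 0 ≤ C := (norm_nonneg _).trans (hC (Classical.arbitrary X))
  refine measurable_of_tendsto_metrizable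
    (f := fun n μ => signedIntegral μ (hf.approxBounded C n)) (fun n => ?_)
    (tendsto_pi_nhds.mpr fun μ => ?_)
  · set g := hf.approxBounded C n
    have key : ∀ (m : Measure X) [IsFiniteMeasure m],
        ∫ x, g x ∂m = ∑ y ∈ g.range, m.real (g ⁻¹' {y}) • y := by
      intro m _
      rw [← SimpleFunc.integral_eq_integral _ (SimpleFunc.integrable_of_isFiniteMeasure g),
        SimpleFunc.integral_eq]
    -- On simple functions the two Jordan parts enter only through their difference, the evaluation
    -- of `μ`; no measurability of either part in `μ` is needed.
    have : (fun μ : SignedMeasure X => signedIntegral μ g) =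
        fun μ => ∑ y ∈ g.range, μ (g ⁻¹' {y}) • y := by
      funext μ
      rw [signedIntegral, key, key, ← Finset.sum_sub_distrib]
      refine Finset.sum_congr rfl fun y _ => ?_
      rw [μ.apply_eq_posPart_real_sub_negPart_real (g.measurableSet_fiber y), sub_smul]
    rw [this]
    exact Finset.measurable_sum _ fun y _ =>
      (measurable_signedMeasure_apply (g.measurableSet_fiber y)).smul_const y
  · have key : ∀ (m : Measure X) [IsFiniteMeasure m],
        Tendsto (fun n => ∫ x, hf.approxBounded C n x ∂m) atTop (𝓝 (∫ x, f x ∂m)) := fun m _ =>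
      tendsto_integral_of_dominated_convergence (fun _ => C)
        (fun n => (hf.approxBounded C n).aestronglyMeasurable) (integrable_const _)
        (fun n => Eventually.of_forall fun x => hf.norm_approxBounded_le hC0 n x)
        (Eventually.of_forall fun x => hf.tendsto_approxBounded_of_norm_le (hC x))
    exact (key _).sub (key _)

end SignedIntegral

/-! ### Countable subbasis and Borel sets of the weak topology. -/

section WeakTopology

theorem isOpen_iUnion_of_subset_countableBasis {Ω : Type*} [TopologicalSpace Ω]
    [SecondCountableTopology Ω] {T : Finset (Set Ω)}
    (hT : (T : Set (Set Ω)) ⊆ TopologicalSpace.countableBasis Ω) : IsOpen (⋃ t ∈ T, t) :=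
  isOpen_biUnion fun _ ht => TopologicalSpace.isOpen_of_mem_countableBasis (hT ht)

variable {Ω : Type*} [MeasurableSpace Ω] [TopologicalSpace Ω] [OpensMeasurableSpace Ω]

/-- A countable subbasis of the weak topology. -/
def weakSubbasis (Ω : Type*) [MeasurableSpace Ω] [TopologicalSpace Ω]
    [SecondCountableTopology Ω] : Set (Set (ProbabilityMeasure Ω)) :=
  (fun p : Finset (Set Ω) × ℚ => {μ : ProbabilityMeasure Ω | Real.toNNReal p.2 < μ (⋃ t ∈ p.1, t)}) ''
    ({T : Finset (Set Ω) | (T : Set (Set Ω)) ⊆ TopologicalSpace.countableBasis Ω} ×ˢ Set.univ)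

theorem isOpen_lt_probabilityMeasure [HasOuterApproxClosed Ω] {G : Set Ω} (hG : IsOpen G)
    (q : NNReal) : IsOpen {μ : ProbabilityMeasure Ω | q < μ G} := by
  rw [isOpen_iff_mem_nhds]
  intro μ hμ
  have h := ProbabilityMeasure.le_liminf_measure_open_of_tendsto (L := 𝓝 μ) tendsto_id hG
  have hlt : (q : ENNReal) < (μ : Measure Ω) G := by
    rw [← ProbabilityMeasure.ennreal_coeFn_eq_coeFn_toMeasure]
    exact_mod_cast hμ
  filter_upwards [eventually_lt_of_lt_liminf (hlt.trans_le h)] with ν hν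
  rw [id, ← ProbabilityMeasure.ennreal_coeFn_eq_coeFn_toMeasure] at hν
  exact_mod_cast hν

variable [SecondCountableTopology Ω]

theorem countable_weakSubbasis {Ω : Type*} [MeasurableSpace Ω] [TopologicalSpace Ω]
    [SecondCountableTopology Ω] : (weakSubbasis Ω).Countable := by
  refine Set.Countable.image (Set.Countable.prod ?_ (Set.to_countable _)) _
  refine ((Set.countable_ofPred_finite_subset
    (TopologicalSpace.countable_countableBasis Ω)).preimage_of_injOn
      (f := fun T : Finset (Set Ω) => (T : Set (Set Ω))) Finset.coe_injective.injOn).mono ?_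
  exact fun T hT => ⟨T.finite_toSet, hT⟩

/-- The portmanteau theorem in both directions: masses of open sets are lower semicontinuous, and
conversely this semicontinuity characterizes weak convergence. Finite unions of basic open sets
suffice because they exhaust an open set in mass. Countability yields both second countability,
needed to iterate the construction, and a description of the Borel sets by evaluations. -/
theorem probabilityMeasure_topology_eq_generateFrom [HasOuterApproxClosed Ω] :
    (inferInstance : TopologicalSpace (ProbabilityMeasure Ω)) =
      TopologicalSpace.generateFrom (weakSubbasis Ω) := by
  refine le_antisymm (le_generateFrom ?_) ?_
  · rintro _ ⟨⟨T, q⟩, ⟨hT, -⟩, rfl⟩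
    exact isOpen_lt_probabilityMeasure (isOpen_iUnion_of_subset_countableBasis hT) _
  · have hsc : @SecondCountableTopology _ (TopologicalSpace.generateFrom (weakSubbasis Ω)) :=
      @SecondCountableTopology.mk _ (TopologicalSpace.generateFrom (weakSubbasis Ω))
        ⟨weakSubbasis Ω, countable_weakSubbasis, rfl⟩
    rw [← continuous_id_iff_le, @continuous_iff_continuousAt]
    intro μ
    -- The liminf criterion is used along a countably generated filter; here this comes from the
    -- countable subbasis.
    have hcg : (@nhds _ (TopologicalSpace.generateFrom (weakSubbasis Ω)) μ).IsCountablyGenerated :=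
      @FirstCountableTopology.nhds_generated_countable _
        (TopologicalSpace.generateFrom (weakSubbasis Ω)) _ μ
    refine tendsto_of_forall_isOpen_le_liminf fun G hG => ?_
    refine (le_liminf_iff (isCoboundedUnder_ge_of_le (x := 1) _ (by simp))
      (by isBoundedDefault)).2 fun r hr => ?_
    obtain ⟨T, hT, hlt, hsub⟩ := μ.exists_lt_measure_biUnion_of_isOpen
      (S := TopologicalSpace.countableBasis Ω) (fun u hu x hx => by
        obtain ⟨s, hs, hxs, hsu⟩ :=
          (TopologicalSpace.isBasis_countableBasis Ω).exists_subset_of_mem_open hx hu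
        exact ⟨s, hs, (TopologicalSpace.isOpen_of_mem_countableBasis hs).mem_nhds hxs, hsu⟩) hG hr
    obtain ⟨q, -, hq1, hq2⟩ := NNReal.lt_iff_exists_rat_btwn _ _ |>.mp hlt
    have hmem : {ν : ProbabilityMeasure Ω | Real.toNNReal q < ν (⋃ t ∈ T, t)} ∈ weakSubbasis Ω :=
      ⟨(T, q), ⟨hT, trivial⟩, rfl⟩
    have : {ν : ProbabilityMeasure Ω | Real.toNNReal q < ν (⋃ t ∈ T, t)} ∈
        @nhds _ (TopologicalSpace.generateFrom (weakSubbasis Ω)) μ :=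
      by
        rw [TopologicalSpace.nhds_generateFrom]
        exact mem_iInf_of_mem _ (mem_iInf_of_mem ⟨hq2, hmem⟩ (mem_principal_self _))
    filter_upwards [this] with ν hν
    exact (hq1.trans hν).trans_le (ProbabilityMeasure.apply_mono _ hsub)

instance secondCountableTopology_probabilityMeasure [HasOuterApproxClosed Ω] :
    SecondCountableTopology (ProbabilityMeasure Ω) :=
  ⟨⟨weakSubbasis Ω, countable_weakSubbasis, probabilityMeasure_topology_eq_generateFrom⟩⟩

/-- The Borel `σ`-algebra of the weak topology is contained in every `σ`-algebra for which the
evaluations are measurable. -/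
theorem borel_probabilityMeasure_le [HasOuterApproxClosed Ω]
    (m : MeasurableSpace (ProbabilityMeasure Ω))
    (hm : ∀ B : Set Ω, MeasurableSet B →
      Measurable[m] fun μ : ProbabilityMeasure Ω => (μ : Measure Ω).real B) :
    borel (ProbabilityMeasure Ω) ≤ m := by
  rw [borel_eq_generateFrom_of_subbasis probabilityMeasure_topology_eq_generateFrom]
  refine MeasurableSpace.generateFrom_le ?_
  rintro _ ⟨⟨T, q⟩, ⟨hT, -⟩, rfl⟩
  have := hm _ (isOpen_iUnion_of_subset_countableBasis hT).measurableSet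
    (measurableSet_Ioi (a := ((Real.toNNReal q : NNReal) : ℝ)))
  exact this

end WeakTopology

/-! ### Weak convergence and vector-valued integrands. -/

section VectorIntegral

variable {Ω : Type*} [MeasurableSpace Ω] [TopologicalSpace Ω] [OpensMeasurableSpace Ω]
variable {F : Type*} [NormedAddCommGroup F] [NormedSpace ℝ F] [TopologicalSpace.SeparableSpace F]

/-- A bounded continuous function with values in a separable normed space is, up to `ε` and a small
multiple of a bounded continuous function that is small in the mean, a finite combination
of vectors with bounded continuous coefficients. -/
theorem exists_finite_approx {Ω : Type*} [TopologicalSpace Ω] {f : Ω → F}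
    (hf : Continuous f) {K : ℝ} (hK : ∀ x, ‖f x‖ ≤ K)
    {ε : ℝ} (hε : 0 < ε) :
    ∃ (y : ℕ → F) (c : ℕ → ℕ → Ω → ℝ) (h : ℕ → Ω → ℝ),
      (∀ N i, Continuous (c N i)) ∧ (∀ N i x, ‖c N i x‖ ≤ 1) ∧
      (∀ N, Continuous (h N)) ∧ (∀ N x, ‖h N x‖ ≤ 1) ∧
      (∀ x, Tendsto (fun N => h N x) atTop (𝓝 0)) ∧
      ∀ N x, ‖f x - ∑ i ∈ Finset.range N, c N i x • y i‖ ≤ 2 * ε + K * h N x := by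
  let y := TopologicalSpace.denseSeq F
  -- The tent `w i` is supported where `f` is within `2 ε` of `y i`. Dividing by the partial sum,
  -- cut off below at `ε` to keep the quotient continuous, gives a partition of unity up to the
  -- defect `1 - s N / d N`. This defect vanishes once `N` exceeds an index `i` with `‖f x - y i‖ <
  -- ε`.
  let w : ℕ → Ω → ℝ := fun i x => max 0 (2 * ε - ‖f x - y i‖)
  let s : ℕ → Ω → ℝ := fun N x => ∑ i ∈ Finset.range N, w i x
  let d : ℕ → Ω → ℝ := fun N x => max (s N x) ε
  have hw0 : ∀ i x, 0 ≤ w i x := fun i x => le_max_left _ _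
  have hs0 : ∀ N x, 0 ≤ s N x := fun N x => Finset.sum_nonneg fun i _ => hw0 i x
  have hd0 : ∀ N x, 0 < d N x := fun N x => hε.trans_le (le_max_right _ _)
  have hsd : ∀ N x, s N x ≤ d N x := fun N x => le_max_left _ _
  have hwc : ∀ i, Continuous (w i) := fun i => by fun_prop
  have hsc : ∀ N, Continuous (s N) := fun N => continuous_finsetSum _ fun i _ => hwc i
  have hdc : ∀ N, Continuous (d N) := fun N => (hsc N).max continuous_const
  refine ⟨y, fun N i x => if i < N then w i x / d N x else 0, fun N x => 1 - s N x / d N x,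
    fun N i => ?_, fun N i x => ?_, fun N => ?_, fun N x => ?_, fun x => ?_, fun N x => ?_⟩
  · dsimp only
    split_ifs
    · exact (hwc i).div (hdc N) fun x => (hd0 N x).ne'
    · exact continuous_const
  · dsimp only
    split_ifs with hi
    · rw [Real.norm_of_nonneg (div_nonneg (hw0 _ _) (hd0 _ _).le), div_le_one (hd0 _ _)]
      refine le_trans ?_ (hsd N x)
      exact Finset.single_le_sum (f := fun i => w i x) (fun i _ => hw0 i x)
        (Finset.mem_range.mpr hi)
    · simp
  · exact continuous_const.sub ((hsc N).div (hdc N) fun x => (hd0 N x).ne')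
  · have h1 : s N x / d N x ≤ 1 := (div_le_one (hd0 _ _)).mpr (hsd N x)
    have h2 : 0 ≤ s N x / d N x := div_nonneg (hs0 _ _) (hd0 _ _).le
    rw [Real.norm_eq_abs, abs_le]
    constructor <;> linarith
  · obtain ⟨i, hi⟩ := (TopologicalSpace.denseRange_denseSeq F).exists_dist_lt (f x) hε
    refine tendsto_const_nhds.congr' ?_
    filter_upwards [eventually_gt_atTop i] with N hN
    have h1 : ε ≤ w i x := by
      rw [dist_eq_norm] at hi
      exact le_max_of_le_right (by linarith)
    have h2 : w i x ≤ s N x := Finset.single_le_sum (f := fun i => w i x) (fun i _ => hw0 i x)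
        (Finset.mem_range.mpr hN)
    have h3 : d N x = s N x := max_eq_left (h1.trans h2)
    rw [h3, div_self (by linarith), sub_self]
  · have hsum : ∑ i ∈ Finset.range N, (if i < N then w i x / d N x else 0) • y i =
        ∑ i ∈ Finset.range N, (w i x / d N x) • y i :=
      Finset.sum_congr rfl fun i hi => by rw [if_pos (Finset.mem_range.mp hi)]
    have hsplit : f x - ∑ i ∈ Finset.range N, (w i x / d N x) • y i =
        (1 - s N x / d N x) • f x + ∑ i ∈ Finset.range N, (w i x / d N x) • (f x - y i) := by
      simp only [smul_sub, Finset.sum_sub_distrib, ← Finset.sum_smul, ← Finset.sum_div, sub_smul,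
        one_smul]
      simp only [s]
      abel
    have h1 : s N x / d N x ≤ 1 := (div_le_one (hd0 _ _)).mpr (hsd N x)
    have hterm : ∀ i, ‖(w i x / d N x) • (f x - y i)‖ ≤ (w i x / d N x) * (2 * ε) := by
      intro i
      rw [norm_smul, Real.norm_of_nonneg (div_nonneg (hw0 _ _) (hd0 _ _).le)]
      by_cases hi : ‖f x - y i‖ ≤ 2 * ε
      · exact mul_le_mul_of_nonneg_left hi (div_nonneg (hw0 _ _) (hd0 _ _).le)
      · have : w i x = 0 := max_eq_left (by linarith [not_le.mp hi])
        simp [this]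
    rw [hsum, hsplit]
    refine (norm_add_le _ _).trans ?_
    rw [add_comm]
    refine add_le_add ?_ ?_
    · refine (norm_sum_le_of_le _ fun i _ => hterm i).trans ?_
      rw [← Finset.sum_mul, ← Finset.sum_div]
      exact mul_le_of_le_one_left (by linarith) h1
    · rw [norm_smul, Real.norm_of_nonneg (by linarith), mul_comm]
      exact mul_le_mul_of_nonneg_right (hK x) (by linarith)

theorem continuous_integral_real {g : Ω → ℝ} (hg : Continuous g) {C : ℝ} (hC : ∀ x, ‖g x‖ ≤ C) :
    Continuous fun μ : ProbabilityMeasure Ω => ∫ x, g x ∂(μ : Measure Ω) :=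
  ProbabilityMeasure.continuous_integral_boundedContinuousFunction
    (BoundedContinuousFunction.ofNormedAddCommGroup g hg C hC)

/-- Integrals of bounded continuous functions with values in a separable Banach space are continuous
for weak convergence. -/
theorem continuous_integral_of_bounded [CompleteSpace F] {f : Ω → F} (hf : Continuous f) {K : ℝ}
    (hK : ∀ x, ‖f x‖ ≤ K) :
    Continuous fun μ : ProbabilityMeasure Ω => ∫ x, f x ∂(μ : Measure Ω) := by
  rw [continuous_iff_continuousAt]
  intro μ
  rw [ContinuousAt, Metric.tendsto_nhds]
  intro δ hδ
  have hK0 : 0 ≤ K := by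
    obtain ⟨x⟩ := μ.nonempty
    exact (norm_nonneg _).trans (hK x)
  -- The final estimate is twice `2 * ε + K * ε` plus `ε`, that is `ε * (2 * K + 5)`; the larger
  -- constants leave room for strict inequality.
  obtain ⟨ε, hε, hεδ⟩ : ∃ ε > 0, ε * (2 * K + 6) < δ :=
    ⟨δ / (2 * K + 7), by positivity, by
      rw [div_mul_eq_mul_div, div_lt_iff₀ (by positivity)]; nlinarith⟩
  let : MeasurableSpace F := borel F
  have : BorelSpace F := ⟨rfl⟩
  have : SecondCountableTopology F := UniformSpace.secondCountable_of_separable F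
  obtain ⟨y, c, h, hcc, hc1, hhc, hh1, hh0, hfin⟩ := exists_finite_approx hf hK hε
  have hlim : Tendsto (fun N => ∫ x, h N x ∂(μ : Measure Ω)) atTop (𝓝 0) := by
    have := tendsto_integral_of_dominated_convergence (μ := (μ : Measure Ω)) (f := fun _ => (0 : ℝ))
      (F := h) (fun _ => 1)
      (fun n => (hhc n).measurable.aestronglyMeasurable) (integrable_const _)
      (fun n => Eventually.of_forall (hh1 n)) (Eventually.of_forall hh0)
    simpa using this
  obtain ⟨N, hN⟩ := (hlim.eventually_lt_const hε).exists
  have hhN := (continuous_integral_real (hhc N) (hh1 N)).tendsto μ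
  set g : Ω → F := fun x => ∑ i ∈ Finset.range N, c N i x • y i
  have hci : ∀ (ν : ProbabilityMeasure Ω) i, Integrable (c N i) (ν : Measure Ω) := fun ν i =>
    Integrable.of_bound (hcc N i).measurable.aestronglyMeasurable 1
      (Eventually.of_forall (hc1 N i))
  have hgi : ∀ ν : ProbabilityMeasure Ω, Integrable g (ν : Measure Ω) := fun ν =>
    integrable_finsetSum _ fun i _ => (hci ν i).smul_const _
  have hgint : ∀ ν : ProbabilityMeasure Ω, ∫ x, g x ∂(ν : Measure Ω) =
      ∑ i ∈ Finset.range N, (∫ x, c N i x ∂(ν : Measure Ω)) • y i := fun ν => by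
    rw [integral_finsetSum _ fun i _ => (hci ν i).smul_const _]
    exact Finset.sum_congr rfl fun i _ => integral_smul_const _ _
  have hgc : Continuous fun ν : ProbabilityMeasure Ω => ∫ x, g x ∂(ν : Measure Ω) := by
    simp only [hgint]
    exact continuous_finsetSum _ fun i _ =>
      (continuous_integral_real (hcc N i) (hc1 N i)).smul continuous_const
  have hfi : ∀ ν : ProbabilityMeasure Ω, Integrable f (ν : Measure Ω) := fun ν =>
    Integrable.of_bound hf.measurable.aestronglyMeasurable K (Eventually.of_forall hK)
  have hclose : ∀ ν : ProbabilityMeasure Ω, ∫ x, h N x ∂(ν : Measure Ω) < ε →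
      ‖∫ x, f x ∂(ν : Measure Ω) - ∫ x, g x ∂(ν : Measure Ω)‖ ≤ 2 * ε + K * ε := by
    intro ν hν
    have hhi : Integrable (h N) (ν : Measure Ω) :=
      Integrable.of_bound (hhc N).measurable.aestronglyMeasurable 1 (Eventually.of_forall (hh1 N))
    rw [← integral_sub (hfi ν) (hgi ν)]
    refine (norm_integral_le_of_norm_le ((integrable_const (2 * ε)).add (hhi.const_mul K))
      (Eventually.of_forall (hfin N))).trans ?_
    rw [integral_add' (integrable_const _) (hhi.const_mul K), integral_const, integral_const_mul]
    simp only [probReal_univ, one_smul]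
    gcongr
  filter_upwards [hhN.eventually_lt_const hN, Metric.tendsto_nhds.mp (hgc.tendsto μ) ε hε]
    with ν hν1 hν2
  have h1 := hclose ν hν1
  have h2 := hclose μ hN
  rw [dist_eq_norm] at hν2 ⊢
  calc ‖∫ x, f x ∂(ν : Measure Ω) - ∫ x, f x ∂(μ : Measure Ω)‖
      = ‖(∫ x, f x ∂(ν : Measure Ω) - ∫ x, g x ∂(ν : Measure Ω))
        + (∫ x, g x ∂(ν : Measure Ω) - ∫ x, g x ∂(μ : Measure Ω))
        - (∫ x, f x ∂(μ : Measure Ω) - ∫ x, g x ∂(μ : Measure Ω))‖ := by congr 1; abel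
    _ ≤ (2 * ε + K * ε) + ε + (2 * ε + K * ε) :=
      (norm_sub_le _ _).trans (add_le_add ((norm_add_le _ _).trans (add_le_add h1 hν2.le)) h2)
    _ < δ := by nlinarith

end VectorIntegral

/-! ### Convergence and separability in `ℓ¹` sums. -/

section SummableSequences

variable {G : ℕ → Type*} [∀ m, NormedAddCommGroup (G m)]

theorem lp_one_norm_eq_tsum (f : lp G 1) : ‖f‖ = ∑' m, ‖f m‖ := by
  rw [lp.norm_eq_tsum_rpow (by simp) f]
  simp

theorem lp_one_summable (f : lp G 1) : Summable fun m => ‖f m‖ := by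
  simpa using (lp.memℓp f).summable (by simp)

/-- Dominated convergence for series: a summable majorant turns levelwise convergence into norm
convergence. -/
theorem lp_one_tendsto {ι : Type*} {l : Filter ι} {f : ι → lp G 1} {g : lp G 1} {b : ℕ → ℝ}
    (hb : Summable b) (hle : ∀ᶠ i in l, ∀ m, ‖f i m‖ ≤ b m)
    (h : ∀ m, Tendsto (fun i => f i m) l (𝓝 (g m))) : Tendsto f l (𝓝 g) := by
  rw [tendsto_iff_norm_sub_tendsto_zero]
  have h0 : ∑' m : ℕ, (0 : ℝ) = 0 := tsum_zero
  simp only [lp_one_norm_eq_tsum]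
  rw [← h0]
  refine tendsto_tsum_of_dominated_convergence (hb.add (lp_one_summable g)) (fun m => ?_) ?_
  · exact tendsto_iff_norm_sub_tendsto_zero.mp (h m)
  · filter_upwards [hle] with i hi m
    rw [norm_norm]
    exact (norm_sub_le _ _).trans (add_le_add (hi m) le_rfl)

theorem lp_one_separableSpace [∀ m, NormedSpace ℝ (G m)]
    [∀ m, TopologicalSpace.SeparableSpace (G m)] :
    TopologicalSpace.SeparableSpace (lp G 1) := by
  rw [← TopologicalSpace.isSeparable_univ_iff]
  have h1 : TopologicalSpace.IsSeparable
      (⋃ m, Set.range (lp.single (E := G) 1 m)) :=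
    TopologicalSpace.IsSeparable.iUnion fun m =>
      TopologicalSpace.isSeparable_range (lp.isometry_single m).continuous
  refine (h1.span (R := ℝ)).closure.mono fun f _ => ?_
  refine mem_closure_of_tendsto (lp.hasSum_single (by simp) f)
    (Eventually.of_forall fun s => ?_)
  exact Submodule.sum_mem _ fun m _ =>
    Submodule.subset_span (Set.mem_iUnion.mpr ⟨m, ⟨f m, rfl⟩⟩)

end SummableSequences

/-! ### Continuity and exponential bounds for tensor products. -/

section TensorPowers

variable (α : AdmissibleNorm.{u}) {E : Type u} [NormedAddCommGroup E] [NormedSpace ℝ E]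

/-- The tensor power as a seminormed space. -/
def toTPow (m : ℕ) : (⨂[ℝ]^m E) ≃ₗ[ℝ] TPow α E m := LinearEquiv.refl ℝ (⨂[ℝ]^m E)

theorem norm_toTPow {m : ℕ} (a : ⨂[ℝ]^m E) : ‖toTPow α m a‖ = α.seminorm E m a := rfl

theorem continuous_tprod (m : ℕ) :
    Continuous fun v : Fin m → E => toTPow α m (PiTensorProduct.tprod ℝ v) := by
  let f : MultilinearMap ℝ (fun _ : Fin m => E) (TPow α E m) :=
    (toTPow α m).toLinearMap.compMultilinearMap (PiTensorProduct.tprod ℝ)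
  exact (f.mkContinuous 1 fun v => by
    rw [one_mul]; exact α.tprod_le E m v).cont

instance separableSpace_TPow [TopologicalSpace.SeparableSpace E] (m : ℕ) :
    TopologicalSpace.SeparableSpace (TPow α E m) := by
  rw [← TopologicalSpace.isSeparable_univ_iff]
  refine ((TopologicalSpace.isSeparable_range (continuous_tprod α (E := E) m)).span
    (R := ℝ)).mono fun a _ => ?_
  have h : (toTPow α m).symm a ∈ Submodule.span ℝ (Set.range (PiTensorProduct.tprod ℝ)) := by
    rw [PiTensorProduct.span_tprod_eq_top]; trivial
  have h2 := Submodule.mem_map_of_mem (f := (toTPow α (E := E) m).toLinearMap) h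
  rw [Submodule.map_span, ← Set.range_comp] at h2
  simpa [Function.comp_def] using h2

/-- The product of tensors followed by a cast, as a bilinear map. -/
def mulCast {i j m : ℕ} (h : i + j = m) :
    TPow α E i →ₗ[ℝ] TPow α E j →ₗ[ℝ] TPow α E m :=
  ((TensorProduct.mk ℝ (⨂[ℝ]^i E) (⨂[ℝ]^j E)).compr₂
    ((TensorPower.mulEquiv.trans (TensorPower.cast ℝ E h)).trans (toTPow α m)).toLinearMap)

theorem mulCast_apply {i j m : ℕ} (h : i + j = m) (a : ⨂[ℝ]^i E) (b : ⨂[ℝ]^j E) :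
    mulCast α h (toTPow α i a) (toTPow α j b) = toTPow α m (TensorPower.cast ℝ E h
      (GradedMonoid.GMul.mul (A := fun i => ⨂[ℝ]^i E) a b)) := rfl

theorem norm_mulCast_le {i j m : ℕ} (h : i + j = m) (a : TPow α E i) (b : TPow α E j) :
    ‖mulCast α h a b‖ ≤ 1 * ‖a‖ * ‖b‖ := by
  rw [one_mul]
  obtain ⟨a, rfl⟩ := (toTPow α i).surjective a
  obtain ⟨b, rfl⟩ := (toTPow α j).surjective b
  rw [mulCast_apply, norm_toTPow, seminorm_cast]
  exact α.mul_le E i j a b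

theorem continuous_tconv {X : Type*} [TopologicalSpace X] {s t : X → ∀ m : ℕ, ⨂[ℝ]^m E}
    (hs : ∀ m, Continuous fun x => toTPow α m (s x m))
    (ht : ∀ m, Continuous fun x => toTPow α m (t x m)) (m : ℕ) :
    Continuous fun x => toTPow α m (tconv (s x) (t x) m) := by
  simp only [tconv, map_sum]
  refine continuous_finsetSum _ fun i _ => ?_
  simp only [← mulCast_apply]
  exact (((mulCast α _).mkContinuous₂ 1 (norm_mulCast_le α _)).continuous.comp (hs i)).clm_apply
    (ht (m - i))

/-- The product `exp v₁ ⋯ exp vₙ` of exponentials of the vectors in a list. -/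
noncomputable def expProd (l : List E) : ∀ m : ℕ, ⨂[ℝ]^m E :=
  l.foldr (fun v s => tconv (texp v) s) tone

theorem expProd_cons (v : E) (l : List E) : expProd (v :: l) = tconv (texp v) (expProd l) := rfl

theorem continuous_texp (m : ℕ) : Continuous fun v : E => toTPow α m (texp v m) := by
  have h : (fun v : E => toTPow α m (texp v m)) = fun v : E =>
      ((m.factorial : ℝ)⁻¹) • toTPow α m (PiTensorProduct.tprod ℝ fun _ : Fin m => v) :=
    funext fun v => map_smul _ _ _
  have h2 : Continuous fun v : E => (fun _ : Fin m => v) := continuous_pi fun _ => continuous_id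
  rw [h]
  exact (continuous_const_smul ((m.factorial : ℝ)⁻¹)).comp ((continuous_tprod α m).comp h2)

theorem continuous_expProd_ofFn (n m : ℕ) :
    Continuous fun v : Fin n → E => toTPow α m (expProd (List.ofFn v) m) := by
  induction n generalizing m with
  | zero => simp only [List.ofFn_zero]; exact continuous_const
  | succ n ih =>
    simp only [List.ofFn_succ, expProd_cons]
    have h1 : Continuous fun v : Fin (n + 1) → E => v 0 := continuous_apply 0
    have h2 : Continuous fun (v : Fin (n + 1) → E) (i : Fin n) => v i.succ :=
      continuous_pi fun i => continuous_apply i.succ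
    exact continuous_tconv α (X := Fin (n + 1) → E) (s := fun v => texp (v 0))
      (t := fun v => expProd (List.ofFn fun i => v i.succ))
      (fun m => (continuous_texp α m).comp h1) (fun m => (ih m).comp h2) m

/-- The binomial theorem: convolution of majorants `exp a` and `exp b` is `exp (a + b)`. Iterating
it bounds the signature by the exponential series of the total length of the increments, a majorant
that is locally uniform in the path. -/
theorem seminorm_tconv_le {s t : ∀ m : ℕ, ⨂[ℝ]^m E} {a b : ℝ}
    (hs : ∀ m, α.seminorm E m (s m) ≤ a ^ m / m.factorial)
    (ht : ∀ m, α.seminorm E m (t m) ≤ b ^ m / m.factorial) (m : ℕ) :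
    α.seminorm E m (tconv s t m) ≤ (a + b) ^ m / m.factorial := by
  rw [add_pow, Finset.sum_range, Finset.sum_div]
  refine (Finset.le_sum_of_subadditive (α.seminorm E m) (map_zero (α.seminorm E m)).le
    (map_add_le_add _) _ _).trans (Finset.sum_le_sum fun i _ => ?_)
  rw [seminorm_cast]
  refine (α.mul_le E _ _ _ _).trans ((mul_le_mul (hs i) (ht _) (apply_nonneg _ _)
    ((apply_nonneg _ _).trans (hs i))).trans (le_of_eq ?_))
  have hi : (i : ℕ) ≤ m := Nat.lt_succ_iff.mp i.2
  have h := Nat.choose_mul_factorial_mul_factorial hi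
  rw [← h]
  have h1 := Nat.factorial_ne_zero (i : ℕ)
  have h2 := Nat.factorial_ne_zero (m - i)
  have h3 := (Nat.choose_pos hi).ne'
  push_cast
  field_simp

theorem seminorm_expProd_le (l : List E) (m : ℕ) :
    α.seminorm E m (expProd l m) ≤ (l.map norm).sum ^ m / m.factorial := by
  induction l generalizing m with
  | nil =>
    cases m with
    | zero =>
      change α.seminorm E 0 (PiTensorProduct.tprod ℝ fun _ => 0) ≤ _
      simpa using α.tprod_le E 0 (fun _ => 0)
    | succ m =>
      rw [show expProd ([] : List E) (m + 1) = 0 from rfl, map_zero]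
      simp
  | cons v l ih =>
    rw [List.map_cons, List.sum_cons]
    refine seminorm_tconv_le α (fun m => ?_) ih m
    rw [texp, map_smul_eq_mul, Real.norm_of_nonneg (by positivity), div_eq_inv_mul]
    refine mul_le_mul_of_nonneg_left ?_ (by positivity)
    simpa using α.tprod_le E m (fun _ => v)

end TensorPowers

/-! ### Continuity of the signature. -/

section Signature

variable (α : AdmissibleNorm.{u}) {E : Type u} [NormedAddCommGroup E] [NormedSpace ℝ E]

instance separableSpace_timeExt [TopologicalSpace.SeparableSpace E] :
    TopologicalSpace.SeparableSpace (TimeExt E) :=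
  (WithLp.toLp_surjective 1).denseRange.separableSpace (WithLp.prod_continuous_toLp 1 ℝ E)

instance separableSpace_TA [TopologicalSpace.SeparableSpace E] :
    TopologicalSpace.SeparableSpace (TA α E) :=
  lp_one_separableSpace

theorem sigSeries_eq_expProd {T : ℕ} (x : Fin (T + 1) → E) :
    sigSeries x = expProd (List.ofFn (incr x)) := rfl

theorem continuous_incr {E : Type*} [NormedAddCommGroup E] {T : ℕ} :
    Continuous fun x : Fin (T + 1) → E => incr x := by
  refine continuous_pi fun i => ?_
  refine Fin.cases ?_ (fun t => ?_) i
  · exact (WithLp.prod_continuous_toLp 1 ℝ E).comp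
      (continuous_const.prodMk (continuous_apply 0))
  · exact (WithLp.prod_continuous_toLp 1 ℝ E).comp
      (continuous_const.prodMk ((continuous_apply t.succ).sub (continuous_apply t.castSucc)))

theorem continuous_sig {T : ℕ} : Continuous fun x : Fin (T + 1) → E => sig α x := by
  rw [continuous_iff_continuousAt]
  intro x₀
  set R : (Fin (T + 1) → E) → ℝ := fun x => ((List.ofFn (incr x)).map norm).sum with hR
  have hRc : Continuous R := by
    simp only [hR, List.map_ofFn, List.sum_ofFn, Function.comp_def]
    exact continuous_finsetSum _ fun i _ => ((continuous_apply i).comp continuous_incr).norm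
  have hR0 : ∀ x, 0 ≤ R x := fun x => List.sum_nonneg (by simp)
  -- Near `x₀` the total length stays below `R x₀ + 1`, which gives a common majorant.
  refine lp_one_tendsto (b := fun m => (R x₀ + 1) ^ m / m.factorial)
    (Real.summable_pow_div_factorial _) ?_ fun m => ?_
  · filter_upwards [hRc.continuousAt.eventually_lt_const (lt_add_one (R x₀))] with x hx m
    change ‖toCompletion α _ m (sigSeries x m)‖ ≤ _
    rw [norm_toCompletion]
    refine (seminorm_expProd_le α _ m).trans ?_
    have := hR0 x
    gcongr
  · have h := (continuous_expProd_ofFn α (E := TimeExt E) (T + 1) m).comp continuous_incr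
    exact ((UniformSpace.Completion.continuous_coe (TPow α (TimeExt E) m)).comp h).tendsto x₀

theorem tconv_zero_eq_tone (s t : ∀ m : ℕ, ⨂[ℝ]^m E) (hs : s 0 = tone 0) (ht : t 0 = tone 0) :
    tconv s t 0 = tone 0 := by
  refine (Fin.sum_univ_one _).trans ?_
  change TensorPower.cast ℝ E _ (GradedMonoid.GMul.mul (A := fun i => ⨂[ℝ]^i E) (s 0) (t 0)) = _
  rw [hs, ht]
  simp only [tone]
  rw [TensorPower.tprod_mul_tprod, TensorPower.cast_tprod]
  congr 1
  funext i
  exact i.elim0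

theorem expProd_zero (l : List E) : expProd l 0 = tone 0 := by
  induction l with
  | nil => rfl
  | cons v l ih =>
    refine tconv_zero_eq_tone _ _ ?_ ih
    simp only [texp, tone, Nat.factorial_zero, Nat.cast_one, inv_one, one_smul]
    congr 1
    funext i
    exact i.elim0

theorem sig_mem_unitLevel {T : ℕ} (x : Fin (T + 1) → E) : sig α x ∈ unitLevel α E :=
  congrArg (toCompletion α _ 0) (expProd_zero _)

end Signature

/-! ### Existence of tensor normalizations. -/

section Normalization

variable {G : ℕ → Type*} [∀ m, NormedAddCommGroup (G m)] [∀ m, NormedSpace ℝ (G m)]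

theorem norm_pow_smul_le (c : unitInterval) (t : lp G 1) (m : ℕ) :
    ‖(c : ℝ) ^ m • t m‖ ≤ ‖t m‖ := by
  rw [norm_smul, Real.norm_of_nonneg (pow_nonneg c.2.1 m)]
  exact mul_le_of_le_one_left (norm_nonneg _) (pow_le_one₀ c.2.1 c.2.2)

/-- The dilation `(tₘ) ↦ (c ^ m tₘ)` with a factor `c ∈ [0, 1]`. -/
def dilation (c : unitInterval) (t : lp G 1) : lp G 1 :=
  ⟨fun m => (c : ℝ) ^ m • t m, memℓp_gen (by
    simp only [ENNReal.toReal_one, Real.rpow_one]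
    exact Summable.of_nonneg_of_le (fun m => norm_nonneg _) (norm_pow_smul_le c t)
      (lp_one_summable t))⟩

theorem dilation_apply (c : unitInterval) (t : lp G 1) (m : ℕ) :
    dilation c t m = (c : ℝ) ^ m • t m := rfl

theorem norm_dilation_le (c : unitInterval) (t : lp G 1) : ‖dilation c t‖ ≤ ‖t‖ := by
  rw [lp_one_norm_eq_tsum, lp_one_norm_eq_tsum]
  exact (lp_one_summable _).tsum_le_tsum (norm_pow_smul_le c t) (lp_one_summable t)

theorem dilation_sub (c : unitInterval) (t s : lp G 1) :
    dilation c (t - s) = dilation c t - dilation c s := by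
  ext m
  simp [dilation_apply, smul_sub]

theorem continuous_dilation (t : lp G 1) : Continuous fun c => dilation c t := by
  rw [continuous_iff_continuousAt]
  intro c
  refine lp_one_tendsto (lp_one_summable t)
    (Eventually.of_forall fun c m => norm_pow_smul_le c t m) fun m => ?_
  have : Continuous fun c : unitInterval => (c : ℝ) ^ m • t m :=
    (continuous_subtype_val.pow m).smul continuous_const
  exact this.tendsto c

/-- `c + ∑_{m ≥ 1} c ^ m ‖tₘ‖`. -/
noncomputable def levelSum (t : lp G 1) (c : unitInterval) : ℝ :=
  c + (‖dilation c t‖ - ‖t 0‖)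

theorem norm_dilation_eq (c : unitInterval) (t : lp G 1) :
    ‖dilation c t‖ = ‖t 0‖ + ∑' m, (c : ℝ) ^ (m + 1) * ‖t (m + 1)‖ := by
  rw [lp_one_norm_eq_tsum, (lp_one_summable _).tsum_eq_zero_add]
  simp [dilation_apply, norm_smul, abs_of_nonneg c.2.1]

/-- The summand `c` in `levelSum` guarantees slope at least `1`, even when all higher levels of `t`
vanish. So the root is unique and depends in a Lipschitz way on `t`. -/
theorem sub_le_levelSum_sub (t : lp G 1) {c d : unitInterval} (h : c ≤ d) :
    (d : ℝ) - c ≤ levelSum t d - levelSum t c := by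
  have : ‖dilation c t‖ ≤ ‖dilation d t‖ := by
    rw [lp_one_norm_eq_tsum, lp_one_norm_eq_tsum]
    refine (lp_one_summable _).tsum_le_tsum (fun m => ?_) (lp_one_summable _)
    rw [dilation_apply, dilation_apply, norm_smul, norm_smul,
      Real.norm_of_nonneg (pow_nonneg c.2.1 m), Real.norm_of_nonneg (pow_nonneg d.2.1 m)]
    exact mul_le_mul_of_nonneg_right (pow_le_pow_left₀ c.2.1 h m) (norm_nonneg _)
  unfold levelSum
  linarith

theorem abs_sub_le_abs_levelSum_sub (t : lp G 1) (c d : unitInterval) :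
    |(c : ℝ) - d| ≤ |levelSum t c - levelSum t d| := by
  rcases le_total c d with h | h
  · rw [abs_sub_comm, abs_of_nonneg (sub_nonneg.mpr (show (_ : ℝ) ≤ _ from h)), abs_sub_comm]
    exact (sub_le_levelSum_sub t h).trans (le_abs_self _)
  · rw [abs_of_nonneg (sub_nonneg.mpr (show (_ : ℝ) ≤ _ from h))]
    exact (sub_le_levelSum_sub t h).trans (le_abs_self _)

theorem exists_levelSum_eq_one (t : lp G 1) : ∃ c : unitInterval, levelSum t c = 1 := by
  have hc : Continuous (levelSum t) :=
    continuous_subtype_val.add ((continuous_dilation t).norm.sub continuous_const)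
  have h0 : levelSum t 0 = 0 := by simp [levelSum, norm_dilation_eq]
  have h1 : 1 ≤ levelSum t 1 := by
    rw [levelSum, norm_dilation_eq]
    have : 0 ≤ ∑' m, ((1 : unitInterval) : ℝ) ^ (m + 1) * ‖t (m + 1)‖ :=
      tsum_nonneg fun m => mul_nonneg (by simp) (norm_nonneg _)
    simpa using this
  obtain ⟨c, hc⟩ := mem_range_of_exists_le_of_exists_ge hc ⟨0, h0.le.trans zero_le_one⟩ ⟨1, h1⟩
  exact ⟨c, hc⟩

/-- The solution `c` of `c + ∑_{m ≥ 1} c ^ m ‖tₘ‖ = 1`. -/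
noncomputable def dilationFactor (t : lp G 1) : unitInterval := (exists_levelSum_eq_one t).choose

theorem levelSum_dilationFactor (t : lp G 1) : levelSum t (dilationFactor t) = 1 :=
  (exists_levelSum_eq_one t).choose_spec

theorem dilationFactor_pos (t : lp G 1) : 0 < (dilationFactor t : ℝ) := by
  refine lt_of_le_of_ne (dilationFactor t).2.1 fun h => ?_
  have h1 := levelSum_dilationFactor t
  rw [levelSum, norm_dilation_eq, ← h] at h1
  simp at h1

theorem abs_levelSum_sub_le (t s : lp G 1) (c : unitInterval) :
    |levelSum t c - levelSum s c| ≤ 2 * ‖t - s‖ := by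
  have h1 : |‖dilation c t‖ - ‖dilation c s‖| ≤ ‖t - s‖ := by
    refine (abs_norm_sub_norm_le _ _).trans ?_
    rw [← dilation_sub]
    exact norm_dilation_le c _
  have h2 : |‖t 0‖ - ‖s 0‖| ≤ ‖t - s‖ :=
    (abs_norm_sub_norm_le _ _).trans (lp.norm_apply_le_norm one_ne_zero (t - s) 0)
  rw [abs_le] at h1 h2 ⊢
  unfold levelSum
  constructor <;> linarith

theorem continuous_dilationFactor : Continuous (dilationFactor (G := G)) := by
  refine Continuous.subtype_mk (f := fun t : lp G 1 => (dilationFactor t : ℝ)) ?_ _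
  refine (LipschitzWith.of_dist_le_mul (K := 2) fun t s => ?_).continuous
  rw [Real.dist_eq, dist_eq_norm]
  refine (abs_sub_le_abs_levelSum_sub t _ _).trans ?_
  rw [levelSum_dilationFactor, ← levelSum_dilationFactor s, abs_sub_comm]
  exact abs_levelSum_sub_le t s _

/-- The dilation by the dilation factor. -/
noncomputable def tensorNormalization (t : lp G 1) : lp G 1 := dilation (dilationFactor t) t

/-- Bounds the normalization once `t 0` is fixed, and lets the dilation factor be read off from the
norm of the image. The latter is the reason for injectivity: a known positive factor can be undone
level by level. -/
theorem norm_tensorNormalization (t : lp G 1) :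
    ‖tensorNormalization t‖ = ‖t 0‖ + 1 - dilationFactor t := by
  have := levelSum_dilationFactor t
  rw [levelSum] at this
  rw [tensorNormalization]
  linarith

theorem continuous_tensorNormalization : Continuous (tensorNormalization (G := G)) := by
  rw [continuous_iff_continuousAt]
  intro s
  have h1 : Tendsto (fun t : lp G 1 => dilation (dilationFactor t) (t - s)) (𝓝 s) (𝓝 0) := by
    refine squeeze_zero_norm (fun t => norm_dilation_le _ _) ?_
    exact tendsto_iff_norm_sub_tendsto_zero.mp tendsto_id
  have h2 := ((continuous_dilation s).comp continuous_dilationFactor).tendsto s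
  have h3 := h1.add h2
  simp only [dilation_sub, Function.comp_apply, sub_add_cancel, zero_add] at h3
  exact h3

theorem tensorNormalization_injOn (z : G 0) :
    Set.InjOn (tensorNormalization (G := G)) {t | t 0 = z} := by
  intro t ht s hs h
  have ht : t 0 = z := ht
  have hs : s 0 = z := hs
  have h1 := norm_tensorNormalization t
  rw [h, norm_tensorNormalization, ht, hs] at h1
  have h2 : (dilationFactor t : ℝ) = dilationFactor s := by linarith
  ext m
  have h3 : (dilationFactor t : ℝ) ^ m • t m = (dilationFactor s : ℝ) ^ m • s m :=
    congrFun (congrArg Subtype.val h) m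
  rw [h2] at h3
  exact (smul_right_injective _ (pow_pos (dilationFactor_pos s) m).ne') h3

theorem isTensorNormalization_tensorNormalization (α : AdmissibleNorm.{u}) (E : Type u)
    [NormedAddCommGroup E] [NormedSpace ℝ E] :
    IsTensorNormalization α (E := E) tensorNormalization := by
  refine ⟨⟨fun t => dilationFactor t, fun t _ => ⟨dilationFactor_pos t, fun m => rfl⟩⟩,
    ⟨‖toCompletion α (TimeExt E) 0 (tone 0)‖ + 1, fun t ht => ?_⟩,
    continuous_tensorNormalization.continuousOn, tensorNormalization_injOn _⟩
  have ht : t 0 = toCompletion α _ 0 (tone 0) := ht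
  rw [norm_tensorNormalization, ht]
  linarith [dilationFactor_pos t]

end Normalization

/-! ### Shuffles and Chen's theorem on words. -/

section Shuffle

variable {D : Type*}

/-- The list of all shuffles of two words. -/
def shuffle : List D → List D → List (List D)
  | [], w => [w]
  | u, [] => [u]
  | a :: u, b :: w => (shuffle u (b :: w)).map (a :: ·) ++ (shuffle (a :: u) w).map (b :: ·)
  termination_by u w => u.length + w.length

theorem shuffle_nil_left (w : List D) : shuffle [] w = [w] := by
  unfold shuffle; rfl

theorem shuffle_nil_right (u : List D) : shuffle u [] = [u] := by
  cases u <;> (unfold shuffle; rfl)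

theorem shuffle_cons_cons (a b : D) (u w : List D) :
    shuffle (a :: u) (b :: w) =
      (shuffle u (b :: w)).map (a :: ·) ++ (shuffle (a :: u) w).map (b :: ·) := by
  rw [shuffle]

theorem length_of_mem_shuffle {u w z : List D} (hz : z ∈ shuffle u w) :
    z.length = u.length + w.length := by
  induction u, w using shuffle.induct generalizing z with
  | case1 w => simp_all [shuffle_nil_left]
  | case2 u h => simp_all [shuffle_nil_right]
  | case3 a u b w ih1 ih2 =>
    rw [shuffle_cons_cons, List.mem_append, List.mem_map, List.mem_map] at hz
    rcases hz with ⟨y, hy, rfl⟩ | ⟨y, hy, rfl⟩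
    · have := ih1 hy
      simp only [List.length_cons] at this ⊢
      omega
    · have := ih2 hy
      simp only [List.length_cons] at this ⊢
      omega

/-- A function on words that is multiplicative for the shuffle product. -/
def IsShuffleCharacter (φ : List D → ℝ) : Prop :=
  φ [] = 1 ∧ ∀ u w, φ u * φ w = ((shuffle u w).map φ).sum

/-- The base case, the empty product of exponentials: a shuffle of two words is empty only if both
are. -/
theorem isShuffleCharacter_of_cons {φ : List D → ℝ} (h0 : φ [] = 1)
    (h : ∀ a u, φ (a :: u) = 0) : IsShuffleCharacter φ := by
  have hne : ∀ z : List D, z.length ≠ 0 → φ z = 0 := fun z hz => by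
    cases z with
    | nil => simp at hz
    | cons a z => exact h a z
  refine ⟨h0, fun u w => ?_⟩
  by_cases hu : u.length + w.length = 0
  · obtain ⟨hu1, hw1⟩ := Nat.add_eq_zero_iff.mp hu
    rw [List.length_eq_zero_iff] at hu1 hw1
    subst hu1 hw1
    simp [shuffle_nil_left, h0]
  · have h1 : ((shuffle u w).map φ).sum = 0 := by
      refine List.sum_eq_zero fun y hy => ?_
      obtain ⟨z, hz, rfl⟩ := List.mem_map.mp hy
      exact hne z (by rw [length_of_mem_shuffle hz]; exact hu)
    rw [h1]
    by_cases hu1 : u.length = 0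
    · rw [hne w (by omega), mul_zero]
    · rw [hne u hu1, zero_mul]

variable [Zero D]

/-- The convolution of the word functional of the exponential of `t v`, where `χ a` is the value of
the letter `a` at `v`, with a functional `φ` on words. -/
noncomputable def expConv (χ : D → ℝ) (φ : List D → ℝ) (t : ℝ) (w : List D) : ℝ :=
  ∑ i ∈ Finset.range (w.length + 1),
    (t ^ i / i.factorial) * (∏ k ∈ Finset.range i, χ (w.getD k 0)) * φ (w.drop i)

theorem expConv_nil (χ : D → ℝ) (φ : List D → ℝ) (t : ℝ) : expConv χ φ t [] = φ [] := by
  simp [expConv]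

theorem expConv_cons (χ : D → ℝ) (φ : List D → ℝ) (t : ℝ) (a : D) (w : List D) :
    expConv χ φ t (a :: w) = (∑ i ∈ Finset.range (w.length + 1), (t ^ (i + 1) / (i + 1).factorial) *
      ((∏ k ∈ Finset.range i, χ (w.getD k 0)) * χ a) * φ (w.drop i)) + φ (a :: w) := by
  rw [expConv, List.length_cons, Finset.sum_range_succ']
  simp [Finset.prod_range_succ']

theorem expConv_zero (χ : D → ℝ) (φ : List D → ℝ) (w : List D) : expConv χ φ 0 w = φ w := by
  cases w with
  | nil => exact expConv_nil χ φ 0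
  | cons a w => simp [expConv_cons]

/-- Differentiating the exponential strips the first letter, which matches the recursion that
defines shuffles. -/
theorem hasDerivAt_expConv_cons (χ : D → ℝ) (φ : List D → ℝ) (a : D) (w : List D) (t : ℝ) :
    HasDerivAt (fun t => expConv χ φ t (a :: w)) (χ a * expConv χ φ t w) t := by
  simp only [expConv_cons]
  refine HasDerivAt.add_const _ ?_
  rw [expConv, Finset.mul_sum]
  refine HasDerivAt.fun_sum fun i _ => ?_
  have h := (((hasDerivAt_pow (i + 1) t).div_const ((i + 1).factorial : ℝ)).mul_const
    ((∏ k ∈ Finset.range i, χ (w.getD k 0)) * χ a)).mul_const (φ (w.drop i))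
  refine h.congr_deriv ?_
  rw [Nat.factorial_succ, Nat.add_sub_cancel]
  have h1 : (i.factorial : ℝ) ≠ 0 := Nat.cast_ne_zero.mpr i.factorial_ne_zero
  have h2 : ((i : ℝ) + 1) ≠ 0 := by positivity
  push_cast
  field_simp

theorem hasDerivAt_list_sum {ι : Type*} (l : List ι) {f f' : ι → ℝ → ℝ} {t : ℝ}
    (h : ∀ i ∈ l, HasDerivAt (f i) (f' i t) t) :
    HasDerivAt (fun t => (l.map fun i => f i t).sum) (l.map fun i => f' i t).sum t := by
  induction l with
  | nil => simpa using hasDerivAt_const t (0 : ℝ)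
  | cons i l ih =>
    simp only [List.map_cons, List.sum_cons]
    exact (h i (by simp)).add (ih fun j hj => h j (by simp [hj]))

/-- Chen's theorem for one exponential: convolution with the exponential of a vector preserves
shuffle characters. -/
theorem IsShuffleCharacter.expConv {χ : D → ℝ} {φ : List D → ℝ} (hφ : IsShuffleCharacter φ)
    (t : ℝ) : IsShuffleCharacter (expConv χ φ t) := by
  refine ⟨by rw [expConv_nil, hφ.1], fun u w => ?_⟩
  induction u, w using shuffle.induct generalizing t with
  | case1 w => simp [shuffle_nil_left, expConv_nil, hφ.1]
  | case2 u h => simp [shuffle_nil_right, expConv_nil, hφ.1]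
  | case3 a u b w ih1 ih2 =>
    set F : ℝ → List D → ℝ := fun t => HRSig.expConv χ φ t with hF
    -- The product rule removes the first letter of either factor; the induction hypotheses, valid
    -- for all `t`, identify the result with the derivative of the shuffle sum. The difference is
    -- therefore constant, and at `t = 0` it vanishes by the identity for `φ`.
    have hd : ∀ t, HasDerivAt (fun t => F t (a :: u) * F t (b :: w) -
        (((shuffle u (b :: w)).map fun z => F t (a :: z)).sum +
          ((shuffle (a :: u) w).map fun z => F t (b :: z)).sum)) 0 t := by
      intro t
      have h1 := ((hasDerivAt_expConv_cons χ φ a u t).mul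
        (hasDerivAt_expConv_cons χ φ b w t)).sub
        ((hasDerivAt_list_sum (shuffle u (b :: w)) (f := fun z t => F t (a :: z))
          (f' := fun z t => χ a * F t z)
          fun z _ => hasDerivAt_expConv_cons χ φ a z t).add
        (hasDerivAt_list_sum (shuffle (a :: u) w) (f := fun z t => F t (b :: z))
          (f' := fun z t => χ b * F t z)
          fun z _ => hasDerivAt_expConv_cons χ φ b z t))
      refine h1.congr_deriv ?_
      rw [List.sum_map_mul_left, List.sum_map_mul_left, ← ih1 t, ← ih2 t]
      ring
    have hc := is_const_of_deriv_eq_zero (fun t => (hd t).differentiableAt)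
      (fun t => (hd t).deriv) t 0
    have h0 := hφ.2 (a :: u) (b :: w)
    rw [shuffle_cons_cons, List.map_append, List.sum_append, List.map_map, List.map_map] at h0 ⊢
    simp only [hF, expConv_zero] at hc
    simp only [Function.comp_def] at h0 ⊢
    linarith

end Shuffle

/-! ### Word coordinates and reconstruction of the increments. -/

section Coordinates

variable {E : Type u} [NormedAddCommGroup E] [NormedSpace ℝ E]

/-- The functional `f₀ ⊗ ⋯ ⊗ fₘ₋₁` on the `m`-th tensor power. -/
noncomputable def coordLin (f : ℕ → E →L[ℝ] ℝ) (m : ℕ) : (⨂[ℝ]^m E) →ₗ[ℝ] ℝ :=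
  PiTensorProduct.lift ((MultilinearMap.mkPiAlgebra ℝ (Fin m) ℝ).compLinearMap
    (fun i => (f i).toLinearMap))

theorem coordLin_tprod (f : ℕ → E →L[ℝ] ℝ) (m : ℕ) (v : Fin m → E) :
    coordLin f m (PiTensorProduct.tprod ℝ v) = ∏ i : Fin m, f i (v i) := by
  simp [coordLin]

theorem coordLin_cast (f : ℕ → E →L[ℝ] ℝ) {i j : ℕ} (h : i = j) (a : ⨂[ℝ]^i E) :
    coordLin f j (TensorPower.cast ℝ E h a) = coordLin f i a := by
  subst h
  simp [TensorPower.cast_refl]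

/-- Families of functionals indexed by all of `ℕ` make the second factor a plain shift, with no
dependent indices. Both sides are bilinear, so elementary tensors suffice. -/
theorem coordLin_mul (f : ℕ → E →L[ℝ] ℝ) {i j : ℕ} (a : ⨂[ℝ]^i E) (b : ⨂[ℝ]^j E) :
    coordLin f (i + j) (GradedMonoid.GMul.mul (A := fun i => ⨂[ℝ]^i E) a b) =
      coordLin f i a * coordLin (fun k => f (i + k)) j b := by
  let B : (⨂[ℝ]^i E) →ₗ[ℝ] (⨂[ℝ]^j E) →ₗ[ℝ] (⨂[ℝ]^(i + j) E) :=
    (TensorProduct.mk ℝ (⨂[ℝ]^i E) (⨂[ℝ]^j E)).compr₂ TensorPower.mulEquiv.toLinearMap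
  have h : B.compr₂ (coordLin f (i + j)) =
      (LinearMap.mul ℝ ℝ).compl₁₂ (coordLin f i) (coordLin (fun k => f (i + k)) j) := by
    refine PiTensorProduct.ext (MultilinearMap.ext fun v => ?_)
    refine PiTensorProduct.ext (MultilinearMap.ext fun w => ?_)
    change coordLin f (i + j) (GradedMonoid.GMul.mul (A := fun i => ⨂[ℝ]^i E)
      (PiTensorProduct.tprod ℝ v) (PiTensorProduct.tprod ℝ w)) =
      coordLin f i (PiTensorProduct.tprod ℝ v) *
        coordLin (fun k => f (i + k)) j (PiTensorProduct.tprod ℝ w)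
    rw [TensorPower.tprod_mul_tprod, coordLin_tprod, coordLin_tprod, coordLin_tprod,
      Fin.prod_univ_add]
    simp
  exact LinearMap.congr_fun₂ h a b

theorem coordLin_texp (f : ℕ → E →L[ℝ] ℝ) (v : E) (m : ℕ) :
    coordLin f m (texp v m) = (1 ^ m / m.factorial) * ∏ k ∈ Finset.range m, f k v := by
  rw [texp, map_smul, coordLin_tprod, Finset.prod_range, smul_eq_mul, one_pow, one_div]

/-- The coordinate of a tensor series that belongs to a word of functionals. -/
noncomputable def wordCoord (s : ∀ m : ℕ, ⨂[ℝ]^m E) (w : List (E →L[ℝ] ℝ)) : ℝ :=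
  coordLin (fun k => w.getD k 0) w.length (s w.length)

theorem coordLin_congr (f : ℕ → E →L[ℝ] ℝ) (s : ∀ m : ℕ, ⨂[ℝ]^m E) {i j : ℕ} (h : i = j) :
    coordLin f i (s i) = coordLin f j (s j) := by
  rw [h]

theorem wordCoord_tconv_texp (v : E) (s : ∀ m : ℕ, ⨂[ℝ]^m E) (w : List (E →L[ℝ] ℝ)) :
    wordCoord (tconv (texp v) s) w = expConv (fun f => f v) (wordCoord s) 1 w := by
  rw [wordCoord, tconv, map_sum, expConv, Finset.sum_range]
  refine Finset.sum_congr rfl fun i _ => ?_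
  rw [coordLin_cast, coordLin_mul, coordLin_texp]
  congr 1
  simp only [wordCoord, List.getD_eq_getElem?_getD, List.getElem?_drop]
  exact coordLin_congr _ s List.length_drop.symm

theorem isShuffleCharacter_expProd (l : List E) : IsShuffleCharacter (wordCoord (expProd l)) := by
  induction l with
  | nil =>
    refine isShuffleCharacter_of_cons ?_ fun a u => ?_
    · change coordLin _ 0 (PiTensorProduct.tprod ℝ _) = 1
      rw [coordLin_tprod]
      simp
    · exact map_zero (coordLin _ _)
  | cons v l ih =>
    have h : wordCoord (expProd (v :: l)) =
        expConv (fun f : E →L[ℝ] ℝ => f v) (wordCoord (expProd l)) 1 :=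
      funext fun w => wordCoord_tconv_texp v _ w
    rw [h]
    exact ih.expConv 1

theorem wordCoord_expProd_cons (v : E) (l : List E) (w : List (E →L[ℝ] ℝ)) :
    wordCoord (expProd (v :: l)) w = expConv (fun f => f v) (wordCoord (expProd l)) 1 w :=
  wordCoord_tconv_texp v _ w

/-- The telescoping sum `∑ⱼ ℓ(vⱼ) (p(Nⱼ + 1) - p(Nⱼ))`, with `Nⱼ` the number of vectors in the list
after `vⱼ`. -/
noncomputable def stepSum {X : Type*} (ℓ : X → ℝ) : List X → Polynomial ℝ → ℝ
  | [], _ => 0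
  | v :: l, p => stepSum ℓ l p + ℓ v * (p.eval ((l.length : ℝ) + 1) - p.eval (l.length : ℝ))

theorem stepSum_eq_zero {X : Type*} (ℓ : X → ℝ) (l : List X) (p : Polynomial ℝ)
    (h : ∀ k : ℕ, k ≤ l.length → p.eval (k : ℝ) = 0) : stepSum ℓ l p = 0 := by
  induction l with
  | nil => rfl
  | cons v l ih =>
    have h1 := h (l.length + 1) le_rfl
    have h2 := h l.length (by simp)
    push_cast at h1
    rw [stepSum, ih fun k hk => h k (hk.trans (by simp)), h1, h2]
    simp

theorem map_eq_of_stepSum_eq {X : Type*} (ℓ : X → ℝ) (l l' : List X) (hlen : l.length = l'.length)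
    (h : ∀ p, stepSum ℓ l p = stepSum ℓ l' p) : l.map ℓ = l'.map ℓ := by
  induction l generalizing l' with
  | nil => rw [List.length_eq_zero_iff.mp hlen.symm]
  | cons v l ih =>
    cases l' with
    | nil => simp at hlen
    | cons v' l' =>
      have hlen' : l.length = l'.length := by simpa using hlen
      have hv : ℓ v = ℓ v' := by
        -- This polynomial vanishes at `0, …, l.length` but not at `l.length + 1`, so it kills every
        -- term of the telescoping sum except that of the first vector.
        set p : Polynomial ℝ := ∏ k ∈ Finset.range (l.length + 1),
          (Polynomial.X - Polynomial.C (k : ℝ))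
        have hp : ∀ k : ℕ, k ≤ l.length → p.eval (k : ℝ) = 0 := fun k hk => by
          rw [Polynomial.eval_prod]
          exact Finset.prod_eq_zero (Finset.mem_range.mpr (Nat.lt_succ_of_le hk)) (by simp)
        have hp1 : p.eval ((l.length : ℝ) + 1) ≠ 0 := by
          rw [Polynomial.eval_prod]
          refine Finset.prod_ne_zero_iff.mpr fun k hk => ?_
          have : (k : ℝ) < l.length + 1 := by exact_mod_cast Finset.mem_range.mp hk
          simp only [Polynomial.eval_sub, Polynomial.eval_X, Polynomial.eval_C]
          linarith
        have := h p
        rw [stepSum, stepSum, stepSum_eq_zero ℓ l p hp, stepSum_eq_zero ℓ l' p (hlen' ▸ hp),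
          ← hlen', hp _ le_rfl] at this
        simpa [hp1] using this
      rw [List.map_cons, List.map_cons, hv, ih l' hlen' fun p => ?_]
      have := h p
      rw [stepSum, stepSum, hv, hlen'] at this
      linarith

theorem stepSum_add {X : Type*} (ℓ : X → ℝ) (l : List X) (p q : Polynomial ℝ) :
    stepSum ℓ l (p + q) = stepSum ℓ l p + stepSum ℓ l q := by
  induction l with
  | nil => simp [stepSum]
  | cons v l ih => simp only [stepSum, ih, Polynomial.eval_add]; ring

theorem stepSum_monomial {X : Type*} (ℓ : X → ℝ) (l : List X) (n : ℕ) (c : ℝ) :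
    stepSum ℓ l (Polynomial.monomial n c) = c * stepSum ℓ l (Polynomial.X ^ n) := by
  induction l with
  | nil => simp [stepSum]
  | cons v l ih => simp only [stepSum, ih, Polynomial.eval_monomial, Polynomial.eval_pow,
      Polynomial.eval_X]; ring

/-- Constants have zero differences, so the positive powers determine the sum for all polynomials.
-/
theorem stepSum_eq_of_forall_pow {X : Type*} (ℓ : X → ℝ) (l l' : List X)
    (h : ∀ b : ℕ, stepSum ℓ l (Polynomial.X ^ (b + 1)) = stepSum ℓ l' (Polynomial.X ^ (b + 1)))
    (p : Polynomial ℝ) : stepSum ℓ l p = stepSum ℓ l' p := by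
  have h0 : ∀ l : List X, stepSum ℓ l (Polynomial.X ^ 0) = 0 := fun l => by
    induction l with
    | nil => rfl
    | cons v l ih => rw [stepSum, ih]; simp
  induction p using Polynomial.induction_on' with
  | add p q hp hq => rw [stepSum_add, stepSum_add, hp, hq]
  | monomial n c =>
    rw [stepSum_monomial, stepSum_monomial]
    cases n with
    | zero => rw [h0, h0]
    | succ b => rw [h b]

theorem sum_pow_div_factorial (n : ℕ) (x : ℝ) :
    ∑ i ∈ Finset.range (n + 1), (1 / (i.factorial : ℝ)) * (x ^ (n - i) / (n - i).factorial) =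
      (x + 1) ^ n / n.factorial := by
  rw [add_comm x 1, add_pow, Finset.sum_div]
  refine Finset.sum_congr rfl fun i hi => ?_
  have hi : i ≤ n := Nat.lt_succ_iff.mp (Finset.mem_range.mp hi)
  rw [← Nat.choose_mul_factorial_mul_factorial hi]
  have h1 := Nat.factorial_ne_zero i
  have h2 := Nat.factorial_ne_zero (n - i)
  have h3 := (Nat.choose_pos hi).ne'
  push_cast
  field_simp
  simp

theorem prod_getD_replicate {e : E →L[ℝ] ℝ} {v : E} (hv : e v = 1) {b i : ℕ} (hi : i ≤ b) :
    ∏ k ∈ Finset.range i, ((List.replicate b e).getD k 0) v = 1 := by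
  refine Finset.prod_eq_one fun k hk => ?_
  have : k < b := (Finset.mem_range.mp hk).trans_le hi
  simp [List.getD_eq_getElem?_getD, this, hv]

theorem wordCoord_expProd_replicate {e : E →L[ℝ] ℝ} (l : List E) (hl : ∀ v ∈ l, e v = 1) (b : ℕ) :
    wordCoord (expProd l) (List.replicate b e) = (l.length : ℝ) ^ b / b.factorial := by
  induction l generalizing b with
  | nil =>
    cases b with
    | zero => simpa using (isShuffleCharacter_expProd ([] : List E)).1
    | succ b =>
      rw [show wordCoord (expProd ([] : List E)) (List.replicate (b + 1) e) = 0 from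
        map_zero (coordLin _ _)]
      simp
  | cons v l ih =>
    have hl' : ∀ v ∈ l, e v = 1 := fun v hv => hl v (by simp [hv])
    rw [wordCoord_expProd_cons, expConv, List.length_replicate, List.length_cons]
    push_cast
    rw [← sum_pow_div_factorial]
    refine Finset.sum_congr rfl fun i hi => ?_
    have hi : i ≤ b := Nat.lt_succ_iff.mp (Finset.mem_range.mp hi)
    rw [prod_getD_replicate (hl v (by simp)) hi, List.drop_replicate, ih hl']
    simp

/-- If the letter `f` is taken from `vⱼ`, the letters `e` after it come from `vⱼ` or a later vector.
The `Nⱼ` later vectors contribute like one exponential of `Nⱼ`, and summing over how many letters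
`vⱼ` itself supplies gives `((Nⱼ + 1) ^ (b + 1) - Nⱼ ^ (b + 1)) / (b + 1)!` by the binomial theorem.
-/
theorem wordCoord_expProd_cons_replicate {e : E →L[ℝ] ℝ} (f : E →L[ℝ] ℝ) (l : List E)
    (hl : ∀ v ∈ l, e v = 1) (b : ℕ) :
    wordCoord (expProd l) (f :: List.replicate b e) =
      stepSum f l (Polynomial.X ^ (b + 1)) / (b + 1).factorial := by
  induction l with
  | nil =>
    rw [show wordCoord (expProd ([] : List E)) (f :: List.replicate b e) = 0 from
        map_zero (coordLin _ _)]
    simp [stepSum]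
  | cons v l ih =>
    have hl' : ∀ v ∈ l, e v = 1 := fun v hv => hl v (by simp [hv])
    rw [wordCoord_expProd_cons, expConv_cons, ih hl', stepSum, List.length_replicate, add_div,
      add_comm]
    congr 1
    have h := sum_pow_div_factorial (b + 1) (l.length : ℝ)
    rw [Finset.sum_range_succ'] at h
    simp only [Polynomial.eval_pow, Polynomial.eval_X]
    rw [mul_div_assoc, sub_div, ← h]
    simp only [Nat.sub_zero, Nat.factorial_zero, Nat.cast_one, div_one, one_mul, add_sub_cancel_right]
    rw [Finset.mul_sum]
    refine Finset.sum_congr rfl fun i hi => ?_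
    have hi : i ≤ b := Nat.lt_succ_iff.mp (Finset.mem_range.mp hi)
    rw [prod_getD_replicate (hl v (by simp)) hi, List.drop_replicate,
      wordCoord_expProd_replicate l hl', one_pow, Nat.add_sub_add_right]
    ring

theorem eq_of_wordCoord_expProd_eq {e : E →L[ℝ] ℝ} {l l' : List E} (hl : ∀ v ∈ l, e v = 1)
    (hl' : ∀ v ∈ l', e v = 1) (hlen : l.length = l'.length)
    (h : ∀ w, wordCoord (expProd l) w = wordCoord (expProd l') w) : l = l' := by
  have key : ∀ f : E →L[ℝ] ℝ, l.map f = l'.map f := fun f => by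
    refine map_eq_of_stepSum_eq f l l' hlen (stepSum_eq_of_forall_pow f l l' fun b => ?_)
    have := h (f :: List.replicate b e)
    rw [wordCoord_expProd_cons_replicate f l hl, wordCoord_expProd_cons_replicate f l' hl',
      div_left_inj' (Nat.cast_ne_zero.mpr (Nat.factorial_ne_zero _))] at this
    exact this
  refine List.ext_getElem hlen fun i h1 h2 => ?_
  by_contra hne
  -- Hahn–Banach: vectors are determined by their bounded functionals.
  obtain ⟨f, hf⟩ := SeparatingDual.exists_separating_of_ne (R := ℝ) hne
  refine hf ?_
  have := key f
  have h3 := congrArg (fun m : List ℝ => m[i]?) this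
  simpa [h1, h2] using h3

end Coordinates

/-! ### Word functionals on the completed tensor algebra. -/

section Functionals

variable (α : AdmissibleNorm.{u}) {E : Type u} [NormedAddCommGroup E] [NormedSpace ℝ E]

/-- The extension of `f₀ ⊗ ⋯ ⊗ fₘ₋₁` to the completed tensor power. -/
noncomputable def coordCLM (f : ℕ → E →L[ℝ] ℝ) (m : ℕ) :
    UniformSpace.Completion (TPow α E m) →L[ℝ] ℝ :=
  (((coordLin f m).comp (toTPow α m).symm.toLinearMap).mkContinuous (∏ i : Fin m, ‖f i‖)
    fun a => α.dual_le E m (fun i => f i) ((toTPow α m).symm a)).extend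
      UniformSpace.Completion.toComplL

theorem coordCLM_toCompletion (f : ℕ → E →L[ℝ] ℝ) (m : ℕ) (a : ⨂[ℝ]^m E) :
    coordCLM α f m (toCompletion α E m a) = coordLin f m a :=
  ContinuousLinearMap.extend_eq _ UniformSpace.Completion.denseRange_coe
    (UniformSpace.Completion.isUniformInducing_coe _) (toTPow α m a)

/-- The functional on the completed tensor algebra that belongs to a word. -/
noncomputable def wordCLM (w : List (TimeExt E →L[ℝ] ℝ)) : TA α E →L[ℝ] ℝ :=
  (coordCLM α (fun k => w.getD k 0) w.length).comp
    (lp.evalCLM ℝ (fun m : ℕ => UniformSpace.Completion (TPow α (TimeExt E) m)) 1 w.length)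

theorem wordCLM_sig {T : ℕ} (x : Fin (T + 1) → E) (w : List (TimeExt E →L[ℝ] ℝ)) :
    wordCLM α w (sig α x) = wordCoord (sigSeries x) w :=
  coordCLM_toCompletion α _ _ _

end Functionals

/-! ### The algebra of coordinates of the normalized signature. -/

section NormalizedSignature

variable {α : AdmissibleNorm.{u}} {E : Type u} [NormedAddCommGroup E] [NormedSpace ℝ E]
variable {Λ : TA α E → TA α E}

theorem IsTensorNormalization.continuous_comp_sig (hΛ : IsTensorNormalization α Λ) (n : ℕ) :
    Continuous fun x : Fin (n + 1) → E => Λ (sig α x) :=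
  hΛ.2.2.1.comp_continuous (continuous_sig α) (sig_mem_unitLevel α)

theorem IsTensorNormalization.exists_norm_comp_sig_le (hΛ : IsTensorNormalization α Λ) :
    ∃ K : ℝ, ∀ (n : ℕ) (x : Fin (n + 1) → E), ‖Λ (sig α x)‖ ≤ K := by
  obtain ⟨K, hK⟩ := hΛ.2.1
  exact ⟨K, fun n x => hK _ (sig_mem_unitLevel α x)⟩

theorem IsTensorNormalization.exists_wordCLM_eq (hΛ : IsTensorNormalization α Λ) :
    ∃ lam : TA α E → ℝ, ∀ (n : ℕ) (x : Fin (n + 1) → E), 0 < lam (sig α x) ∧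
      ∀ w, wordCLM α w (Λ (sig α x)) = lam (sig α x) ^ w.length * wordCoord (sigSeries x) w := by
  obtain ⟨lam, hlam⟩ := hΛ.1
  refine ⟨lam, fun n x => ⟨(hlam _ (sig_mem_unitLevel α x)).1, fun w => ?_⟩⟩
  rw [← wordCLM_sig α]
  have h := (hlam _ (sig_mem_unitLevel α x)).2 w.length
  change coordCLM α _ _ (Λ (sig α x) w.length) = _ * coordCLM α _ _ (sig α x w.length)
  rw [h, map_smul, smul_eq_mul]

/-- The linear functionals of the normalized signature. -/
noncomputable def coordSubmodule (Λ : TA α E → TA α E) (n : ℕ) :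
    Submodule ℝ ((Fin (n + 1) → E) → ℝ) :=
  Submodule.span ℝ (Set.range fun w x => wordCLM α w (Λ (sig α x)))

theorem exists_clm_of_mem_coordSubmodule {n : ℕ} {a : (Fin (n + 1) → E) → ℝ}
    (ha : a ∈ coordSubmodule Λ n) :
    ∃ L : TA α E →L[ℝ] ℝ, ∀ x, a x = L (Λ (sig α x)) := by
  induction ha using Submodule.span_induction with
  | mem a h =>
    obtain ⟨w, rfl⟩ := h
    exact ⟨wordCLM α w, fun x => rfl⟩
  | zero => exact ⟨0, fun x => rfl⟩
  | add a b _ _ iha ihb =>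
    obtain ⟨L, hL⟩ := iha
    obtain ⟨M, hM⟩ := ihb
    exact ⟨L + M, fun x => by simp [hL, hM]⟩
  | smul c a _ iha =>
    obtain ⟨L, hL⟩ := iha
    exact ⟨c • L, fun x => by simp [hL]⟩

theorem IsTensorNormalization.wordCLM_nil (hΛ : IsTensorNormalization α Λ) (n : ℕ)
    (x : Fin (n + 1) → E) : wordCLM α [] (Λ (sig α x)) = 1 := by
  obtain ⟨lam, hlam⟩ := hΛ.exists_wordCLM_eq
  rw [(hlam n x).2, sigSeries_eq_expProd, (isShuffleCharacter_expProd _).1]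
  simp

/-- The shuffle identity for the normalized signature. -/
theorem IsTensorNormalization.wordCLM_mul (hΛ : IsTensorNormalization α Λ) (n : ℕ)
    (x : Fin (n + 1) → E) (u w : List (TimeExt E →L[ℝ] ℝ)) :
    wordCLM α u (Λ (sig α x)) * wordCLM α w (Λ (sig α x)) =
      ((shuffle u w).map fun z => wordCLM α z (Λ (sig α x))).sum := by
  obtain ⟨lam, hlam⟩ := hΛ.exists_wordCLM_eq
  -- Every shuffle has length `u.length + w.length`, so a single power of `lam` factors out of the
  -- sum.
  have h1 : (shuffle u w).map (fun z => wordCLM α z (Λ (sig α x))) =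
      (shuffle u w).map
        (fun z => lam (sig α x) ^ (u.length + w.length) * wordCoord (sigSeries x) z) :=
    List.map_congr_left fun z hz => by rw [(hlam n x).2, length_of_mem_shuffle hz]
  rw [h1, List.sum_map_mul_left, sigSeries_eq_expProd,
    ← (isShuffleCharacter_expProd (List.ofFn (incr x))).2, (hlam n x).2, (hlam n x).2, pow_add,
    sigSeries_eq_expProd]
  ring

theorem IsTensorNormalization.mul_mem_coordSubmodule (hΛ : IsTensorNormalization α Λ) {n : ℕ}
    {a b : (Fin (n + 1) → E) → ℝ} (ha : a ∈ coordSubmodule Λ n) (hb : b ∈ coordSubmodule Λ n) :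
    a * b ∈ coordSubmodule Λ n := by
  refine Submodule.span_induction₂ (p := fun a b _ _ => a * b ∈ coordSubmodule Λ n)
    ?_ ?_ ?_ ?_ ?_ ?_ ?_ ha hb
  · rintro _ _ ⟨u, rfl⟩ ⟨w, rfl⟩
    have h : ((fun x => wordCLM α u (Λ (sig α x))) * fun x => wordCLM α w (Λ (sig α x)) :
        (Fin (n + 1) → E) → ℝ) =
        ((shuffle u w).map fun z (x : Fin (n + 1) → E) => wordCLM α z (Λ (sig α x))).sum := by
      funext x
      rw [Pi.mul_apply, hΛ.wordCLM_mul, Pi.list_sum_apply]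
      simp [Function.comp_def]
    rw [h]
    refine list_sum_mem fun y hy => ?_
    obtain ⟨z, -, rfl⟩ := List.mem_map.mp hy
    exact Submodule.subset_span ⟨z, rfl⟩
  · intro y _; rw [zero_mul]; exact Submodule.zero_mem _
  · intro y _; rw [mul_zero]; exact Submodule.zero_mem _
  · intro x y z _ _ _ h1 h2; rw [add_mul]; exact Submodule.add_mem _ h1 h2
  · intro x y z _ _ _ h1 h2; rw [mul_add]; exact Submodule.add_mem _ h1 h2
  · intro c x y _ _ h; rw [smul_mul_assoc]; exact Submodule.smul_mem _ c h
  · intro c x y _ _ h; rw [mul_smul_comm]; exact Submodule.smul_mem _ c h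

/-- The algebra of linear functionals of the normalized signature. -/
noncomputable def coordAlgebra (hΛ : IsTensorNormalization α Λ) (n : ℕ) :
    Subalgebra ℝ ((Fin (n + 1) → E) → ℝ) :=
  (coordSubmodule Λ n).toSubalgebra
    (Submodule.subset_span ⟨[], funext fun x => hΛ.wordCLM_nil n x⟩)
    fun _ _ => hΛ.mul_mem_coordSubmodule

theorem apply_incr_eq_one {n : ℕ} (x : Fin (n + 1) → E) :
    ∀ v ∈ List.ofFn (incr x), WithLp.fstL 1 ℝ ℝ E v = 1 := by
  intro v hv
  obtain ⟨i, rfl⟩ := List.mem_ofFn.mp hv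
  refine Fin.cases ?_ (fun t => ?_) i <;> rfl

theorem incr_injective {E : Type*} [NormedAddCommGroup E] {n : ℕ} :
    Function.Injective fun x : Fin (n + 1) → E => incr x := by
  intro x y h
  funext i
  induction i using Fin.induction with
  | zero =>
    have h0 := congrArg (fun v : TimeExt E => v.snd) (congrFun h 0)
    simpa [incr] using h0
  | succ i ih =>
    have h0 := congrArg (fun v : TimeExt E => v.snd) (congrFun h i.succ)
    simp only [incr, Fin.cases_succ] at h0
    change x i.succ - x i.castSucc = y i.succ - y i.castSucc at h0
    rw [ih] at h0
    exact sub_left_injective h0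

theorem IsTensorNormalization.eq_of_forall_wordCLM_eq (hΛ : IsTensorNormalization α Λ) {n : ℕ}
    {x y : Fin (n + 1) → E}
    (h : ∀ w, wordCLM α w (Λ (sig α x)) = wordCLM α w (Λ (sig α y))) : x = y := by
  obtain ⟨lam, hlam⟩ := hΛ.exists_wordCLM_eq
  -- The time letter has coordinate `n + 1` on every signature, hence `lam * (n + 1)` after
  -- normalization; this recovers `lam`.
  have hl : lam (sig α x) = lam (sig α y) := by
    have h1 := h (List.replicate 1 (WithLp.fstL 1 ℝ ℝ E))
    rw [(hlam n x).2, (hlam n y).2, sigSeries_eq_expProd, sigSeries_eq_expProd,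
      wordCoord_expProd_replicate _ (apply_incr_eq_one x),
      wordCoord_expProd_replicate _ (apply_incr_eq_one y)] at h1
    simp only [List.length_replicate, pow_one, List.length_ofFn, Nat.factorial_one, Nat.cast_one,
      div_one] at h1
    exact mul_right_cancel₀ (Nat.cast_ne_zero.mpr n.succ_ne_zero) h1
  have h2 : List.ofFn (incr x) = List.ofFn (incr y) := by
    refine eq_of_wordCoord_expProd_eq (apply_incr_eq_one x) (apply_incr_eq_one y) (by simp)
      fun w => ?_
    have := h w
    rw [(hlam n x).2, (hlam n y).2, hl] at this
    exact mul_left_cancel₀ (pow_pos (hlam n y).1 _).ne' this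
  exact incr_injective (List.ofFn_injective h2)

theorem IsTensorNormalization.injective_comp_sig (hΛ : IsTensorNormalization α Λ) (n : ℕ) :
    Function.Injective fun x : Fin (n + 1) → E => Λ (sig α x) := fun _ _ h =>
  hΛ.eq_of_forall_wordCLM_eq fun w => congrArg (wordCLM α w) h

/-- The integrals of the normalized signature determine measurably the evaluations of finite signed
measures. -/
theorem IsTensorNormalization.measurable_real_sub_real [CompleteSpace E]
    [TopologicalSpace.SeparableSpace E] (hΛ : IsTensorNormalization α Λ) {n : ℕ}
    {X : Type*} [MeasurableSpace X] {G : X → Fin (n + 1) → E}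
    (hG : @Measurable _ _ _ (borel _) G) (hX : ‹MeasurableSpace X› ≤ (borel _).comap G)
    {Y : Type*} [MeasurableSpace Y] (p q : Y → Measure X) [∀ y, IsFiniteMeasure (p y)]
    [∀ y, IsFiniteMeasure (q y)]
    (h : @Measurable _ _ _ (borel _) fun y =>
      ∫ x, Λ (sig α (G x)) ∂(p y) - ∫ x, Λ (sig α (G x)) ∂(q y))
    {B : Set X} (hB : MeasurableSet B) :
    Measurable fun y => (p y).real B - (q y).real B := by
  let : MeasurableSpace (Fin (n + 1) → E) := borel _
  have : BorelSpace (Fin (n + 1) → E) := ⟨rfl⟩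
  let : MeasurableSpace (TA α E) := borel _
  have : BorelSpace (TA α E) := ⟨rfl⟩
  have : SecondCountableTopology E := UniformSpace.secondCountable_of_separable E
  have : SecondCountableTopology (TA α E) := UniformSpace.secondCountable_of_separable _
  obtain ⟨K, hK⟩ := hΛ.exists_norm_comp_sig_le
  have hHG : Measurable fun x => Λ (sig α (G x)) :=
    (hΛ.continuous_comp_sig n).measurable.comp hG
  -- The coordinate algebra is pulled back along `G`, so the Polish space is the path space in `E`,
  -- while `X` needs no topology.
  let φ : ((Fin (n + 1) → E) → ℝ) →ₐ[ℝ] (X → ℝ) :=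
    AlgHom.pi fun x => Pi.evalAlgHom ℝ _ (G x)
  have hrep : ∀ a ∈ (coordAlgebra hΛ n).map φ, ∃ L : TA α E →L[ℝ] ℝ,
      a = fun x => L (Λ (sig α (G x))) := by
    rintro _ ⟨a, ha, rfl⟩
    obtain ⟨L, hL⟩ := exists_clm_of_mem_coordSubmodule ha
    exact ⟨L, funext fun x => hL (G x)⟩
  refine measurable_real_sub_real_of_integral (𝒜 := (coordAlgebra hΛ n).map φ) (fun a ha => ?_)
    (fun a ha => ?_) p q (fun a ha => ?_) (B := B) ?_
  · obtain ⟨L, rfl⟩ := hrep a ha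
    exact L.continuous.measurable.comp hHG
  · obtain ⟨L, rfl⟩ := hrep a ha
    exact ⟨‖L‖ * K, fun x => (L.le_opNorm _).trans
      (mul_le_mul_of_nonneg_left (hK n _) (norm_nonneg _))⟩
  · obtain ⟨L, rfl⟩ := hrep a ha
    have key : ∀ (m : Measure X) [IsFiniteMeasure m],
        ∫ x, L (Λ (sig α (G x))) ∂m = L (∫ x, Λ (sig α (G x)) ∂m) := fun m _ =>
      L.integral_comp_comm (integrable_of_stronglyMeasurable_bdd hHG.stronglyMeasurable
        (fun x => hK n (G x)) m)
    simp only [key, ← map_sub]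
    exact L.continuous.measurable.comp h
  · have h1 := borel_le_generateFrom_posSets (𝒜 := coordAlgebra hΛ n) (fun a ha => by
      obtain ⟨L, hL⟩ := exists_clm_of_mem_coordSubmodule ha
      rw [show a = fun x => L (Λ (sig α x)) from funext hL]
      exact L.continuous.comp (hΛ.continuous_comp_sig n)) (fun x y hxy => by
      by_contra! hne
      exact hxy (hΛ.eq_of_forall_wordCLM_eq fun w =>
        hne _ (Submodule.subset_span ⟨w, rfl⟩)))
    have h2 := hX.trans (MeasurableSpace.comap_mono h1)
    rw [MeasurableSpace.comap_generateFrom] at h2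
    refine MeasurableSpace.generateFrom_mono ?_ _ (h2 _ hB)
    rintro _ ⟨_, ⟨a, ha, rfl⟩, rfl⟩
    exact ⟨φ a, ⟨a, ha, rfl⟩, rfl⟩

end NormalizedSignature

/-! ### Pulled-back `σ`-algebras. -/

section Comap

theorem pi_le_comap {ι X Z : Type*} [mX : MeasurableSpace X] [mZ : MeasurableSpace Z] {g : X → Z}
    (h : mX ≤ mZ.comap g) :
    (MeasurableSpace.pi : MeasurableSpace (ι → X)) ≤
      MeasurableSpace.pi.comap fun (x : ι → X) t => g (x t) := by
  refine iSup_le fun t => ?_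
  refine (MeasurableSpace.comap_mono h).trans ?_
  have h1 : (mZ.comap g).comap (fun x : ι → X => x t) =
      (mZ.comap fun z : ι → Z => z t).comap fun (x : ι → X) t => g (x t) := by
    rw [MeasurableSpace.comap_comp, MeasurableSpace.comap_comp]
    rfl
  rw [h1]
  exact MeasurableSpace.comap_mono (le_iSup (fun t => mZ.comap fun z : ι → Z => z t) t)

/-- Sets in a pulled-back `σ`-algebra are unions of fibres. This turns measurable dependence on the
expected signature into injectivity. -/
theorem eq_of_measurable_comap {Y Z : Type*} [mZ : MeasurableSpace Z] {F : Y → Z} {f : Y → ℝ}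
    (hf : Measurable[mZ.comap F] f) {y y' : Y} (h : F y = F y') : f y = f y' := by
  obtain ⟨S, -, hS⟩ := hf (measurableSet_singleton (f y))
  have h1 : y ∈ F ⁻¹' S := by rw [hS]; rfl
  have h2 : y' ∈ F ⁻¹' S := by
    rw [Set.mem_preimage, ← h]; exact h1
  rw [hS] at h2
  exact h2.symm

end Comap

variable {α : AdmissibleNorm.{u}} {V : Type u} [NormedAddCommGroup V] [NormedSpace ℝ V]
variable (T : ℕ → ℕ) {Λ : ∀ r, TA α (Ta α V r) → TA α (Ta α V r)}

/-! ### Completeness, separability and topology of the higher rank spaces. -/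

section Towers

variable (α V)

instance completeSpace_Ta [h : CompleteSpace V] : ∀ r, CompleteSpace (Ta α V r)
  | 0 => h
  | r + 1 => inferInstanceAs (CompleteSpace (TA α (Ta α V r)))

instance separableSpace_Ta [h : TopologicalSpace.SeparableSpace V] :
    ∀ r, TopologicalSpace.SeparableSpace (Ta α V r)
  | 0 => h
  | r + 1 =>
    have := separableSpace_Ta (h := h) r
    inferInstanceAs (TopologicalSpace.SeparableSpace (TA α (Ta α V r)))

theorem secondCountable_pseudoMetrizable_ProbSp (V : Type u) [NormedAddCommGroup V]
    [h : TopologicalSpace.SeparableSpace V] (r : ℕ) :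
    SecondCountableTopology (ProbSp T V r) ∧
      TopologicalSpace.PseudoMetrizableSpace (ProbSp T V r) := by
  induction r with
  | zero =>
    have : SecondCountableTopology V := UniformSpace.secondCountable_of_separable V
    exact ⟨this, inferInstanceAs (TopologicalSpace.PseudoMetrizableSpace V)⟩
  | succ r ih =>
    obtain ⟨h1, h2⟩ := ih
    let : MeasurableSpace (Fin (T r + 1) → ProbSp T V r) := borel _
    have : BorelSpace (Fin (T r + 1) → ProbSp T V r) := ⟨rfl⟩
    exact ⟨inferInstanceAs (SecondCountableTopology
        (ProbabilityMeasure (Fin (T r + 1) → ProbSp T V r))),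
      inferInstanceAs (TopologicalSpace.PseudoMetrizableSpace
        (ProbabilityMeasure (Fin (T r + 1) → ProbSp T V r)))⟩

end Towers

/-! ### The robust signature of paths. -/

section RobustSig

theorem exists_norm_liftSig_le (hΛ : ∀ r, IsTensorNormalization α (Λ r)) (r : ℕ) :
    ∃ K : ℝ, ∀ {X : Type u} {n : ℕ} (g : X → Ta α V r) (x : Fin (n + 1) → X),
      ‖liftSig Λ g x‖ ≤ K := by
  obtain ⟨K, hK⟩ := (hΛ r).exists_norm_comp_sig_le
  exact ⟨K, fun g x => hK _ _⟩

theorem continuous_liftSig (hΛ : ∀ r, IsTensorNormalization α (Λ r)) {r n : ℕ} {X : Type u}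
    [TopologicalSpace X] {g : X → Ta α V r} (hg : Continuous g) :
    Continuous fun x : Fin (n + 1) → X => liftSig Λ g x :=
  ((hΛ r).continuous_comp_sig n).comp
    (continuous_pi fun t => hg.comp (continuous_apply t))

theorem continuous_robustSig (hΛ : ∀ r, IsTensorNormalization α (Λ r)) (r : ℕ) :
    Continuous (robustSig Λ T r) := by
  induction r with
  | zero => exact continuous_id
  | succ r ih => exact continuous_liftSig hΛ ih

theorem injective_robustSig (hΛ : ∀ r, IsTensorNormalization α (Λ r)) (r : ℕ) :
    Function.Injective (robustSig Λ T r) := by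
  induction r with
  | zero => exact Function.injective_id
  | succ r ih =>
    intro x y h
    have := (hΛ r).injective_comp_sig (T r) h
    funext t
    exact ih (congrFun this t)

end RobustSig

/-! ### The robust expected signature of probability measures. -/

section Probability

theorem norm_robustESig_le (hΛ : ∀ r, IsTensorNormalization α (Λ r)) (r : ℕ) :
    ∃ C : ℝ, ∀ μ : ProbSp T V (r + 1), ‖robustESig Λ T (r + 1) μ‖ ≤ C := by
  obtain ⟨K, hK⟩ := exists_norm_liftSig_le hΛ r
  refine ⟨K, fun μ => ?_⟩
  let : MeasurableSpace (Fin (T r + 1) → ProbSp T V r) := borel _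
  have : IsProbabilityMeasure (BorelProb.toMeasure μ) := Subtype.prop μ
  refine (norm_integral_le_of_norm_le_const (μ := BorelProb.toMeasure μ)
    (Eventually.of_forall fun x => hK (robustESig Λ T r) x)).trans ?_
  simp

variable [TopologicalSpace.SeparableSpace V]

/-- The Borel `σ`-algebra is the one generated by the robust expected signature map. -/
def ESigGenerates (Λ : ∀ r, TA α (Ta α V r) → TA α (Ta α V r)) (r : ℕ) : Prop :=
  Continuous (robustESig Λ T r) ∧
    borel (ProbSp T V r) ≤ (borel (Ta α V r)).comap (robustESig Λ T r)

variable {T}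

theorem ESigGenerates.borel_pi_le {r : ℕ} (h : ESigGenerates T Λ r) :
    borel (Fin (T r + 1) → ProbSp T V r) ≤
      (borel (Fin (T r + 1) → Ta α V r)).comap fun x t => robustESig Λ T r (x t) := by
  obtain ⟨h1, h2⟩ := secondCountable_pseudoMetrizable_ProbSp T V r
  let : MeasurableSpace (ProbSp T V r) := borel _
  have : BorelSpace (ProbSp T V r) := ⟨rfl⟩
  let : MeasurableSpace (Ta α V r) := borel _
  have : BorelSpace (Ta α V r) := ⟨rfl⟩
  have : SecondCountableTopology (Ta α V r) := UniformSpace.secondCountable_of_separable _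
  have := pi_le_comap (ι := Fin (T r + 1)) h.2
  rwa [BorelSpace.measurable_eq (α := Fin (T r + 1) → ProbSp T V r),
    BorelSpace.measurable_eq (α := Fin (T r + 1) → Ta α V r)] at this

theorem ESigGenerates.integrable {r : ℕ} (h : ESigGenerates T Λ r)
    (hΛ : ∀ r, IsTensorNormalization α (Λ r)) (μ : BorelProb (Fin (T r + 1) → ProbSp T V r)) :
    @Integrable _ _ _ _ (borel _) (liftSig Λ (robustESig Λ T r)) μ.toMeasure := by
  let : MeasurableSpace (Fin (T r + 1) → ProbSp T V r) := borel _
  have : BorelSpace (Fin (T r + 1) → ProbSp T V r) := ⟨rfl⟩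
  let : MeasurableSpace (Ta α V (r + 1)) := borel _
  have : BorelSpace (Ta α V (r + 1)) := ⟨rfl⟩
  have : SecondCountableTopology (Ta α V (r + 1)) := UniformSpace.secondCountable_of_separable _
  obtain ⟨K, hK⟩ := exists_norm_liftSig_le hΛ r
  have : IsFiniteMeasure μ.toMeasure := by
    have : IsProbabilityMeasure μ.toMeasure := μ.2
    infer_instance
  exact integrable_of_stronglyMeasurable_bdd
    (continuous_liftSig hΛ h.1).measurable.stronglyMeasurable (fun x => hK _ x) _

/-- The single-rank result applied to the coordinatewise map of the previous rank, with second
measure zero and with the pulled-back `σ`-algebra on the parameters `μ`; for that `σ`-algebra the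
expected signature is trivially measurable. -/
theorem ESigGenerates.measurable_real [CompleteSpace V] {r : ℕ} (h : ESigGenerates T Λ r)
    (hΛ : ∀ r, IsTensorNormalization α (Λ r)) {B : Set (Fin (T r + 1) → ProbSp T V r)}
    (hB : MeasurableSet[borel _] B) :
    Measurable[(borel (Ta α V (r + 1))).comap (robustESig Λ T (r + 1))]
      fun μ : ProbSp T V (r + 1) => (BorelProb.toMeasure μ).real B := by
  let : MeasurableSpace (Fin (T r + 1) → ProbSp T V r) := borel _
  have : BorelSpace (Fin (T r + 1) → ProbSp T V r) := ⟨rfl⟩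
  let m : MeasurableSpace (ProbSp T V (r + 1)) :=
    (borel (Ta α V (r + 1))).comap (robustESig Λ T (r + 1))
  have hfin : ∀ μ : ProbSp T V (r + 1), IsFiniteMeasure (BorelProb.toMeasure μ) := fun μ => by
    have : IsProbabilityMeasure (BorelProb.toMeasure μ) := Subtype.prop μ
    infer_instance
  have hG : Continuous fun (x : Fin (T r + 1) → ProbSp T V r) t => robustESig Λ T r (x t) :=
    continuous_pi fun t => h.1.comp (continuous_apply t)
  have key := (hΛ r).measurable_real_sub_real
    (G := fun (x : Fin (T r + 1) → ProbSp T V r) t => robustESig Λ T r (x t))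
    hG.borel_measurable h.borel_pi_le
    (fun μ : ProbSp T V (r + 1) => BorelProb.toMeasure μ) (fun _ => 0) (by
      simp only [integral_zero_measure, sub_zero]
      exact comap_measurable (m := borel (Ta α V (r + 1))) (robustESig Λ T (r + 1))) hB
  simpa using key

theorem eSigGenerates [CompleteSpace V] (hΛ : ∀ r, IsTensorNormalization α (Λ r)) (r : ℕ) :
    ESigGenerates T Λ r := by
  induction r with
  | zero => exact ⟨continuous_id, MeasurableSpace.comap_id.ge⟩
  | succ r ih =>
    obtain ⟨h1, h2⟩ := secondCountable_pseudoMetrizable_ProbSp T V r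
    let : MeasurableSpace (Fin (T r + 1) → ProbSp T V r) := borel _
    have : BorelSpace (Fin (T r + 1) → ProbSp T V r) := ⟨rfl⟩
    obtain ⟨K, hK⟩ := exists_norm_liftSig_le hΛ r
    refine ⟨?_, ?_⟩
    · exact continuous_integral_of_bounded (continuous_liftSig hΛ ih.1) (K := K) fun x => hK _ x
    · exact borel_probabilityMeasure_le (Ω := Fin (T r + 1) → ProbSp T V r)
        ((borel (Ta α V (r + 1))).comap (robustESig Λ T (r + 1)))
        fun B hB => ih.measurable_real hΛ hB

theorem injective_robustESig [CompleteSpace V] (hΛ : ∀ r, IsTensorNormalization α (Λ r)) (r : ℕ) :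
    Function.Injective (robustESig Λ T (r + 1)) := by
  intro μ ν h
  let : MeasurableSpace (Fin (T r + 1) → ProbSp T V r) := borel _
  have h1 : IsProbabilityMeasure (BorelProb.toMeasure μ) := Subtype.prop μ
  have h2 : IsProbabilityMeasure (BorelProb.toMeasure ν) := Subtype.prop ν
  refine Subtype.ext (Measure.ext fun B hB => ?_)
  have := eq_of_measurable_comap (mZ := borel (Ta α V (r + 1)))
      ((eSigGenerates hΛ r).measurable_real hΛ hB) h
  rwa [measureReal_eq_measureReal_iff] at this

end Probability

/-! ### The robust expected signature of signed measures. -/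

section SignedMeasures

variable [TopologicalSpace.SeparableSpace V]

/-- The `σ`-algebra on signed measures of higher rank is the one generated by the robust expected
signature map. -/
def ESigMGenerates (Λ : ∀ r, TA α (Ta α V r) → TA α (Ta α V r)) (r : ℕ) : Prop :=
  @Measurable _ _ _ (borel _) (robustESigM Λ T r) ∧
    (inferInstance : MeasurableSpace (MeasSp T V r)) ≤
      (borel (Ta α V r)).comap (robustESigM Λ T r)

variable {T}

theorem ESigMGenerates.measurable_pi {r : ℕ} (h : ESigMGenerates T Λ r) :
    @Measurable _ _ _ (borel _)
      fun (x : Fin (T r + 1) → MeasSp T V r) t => robustESigM Λ T r (x t) := by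
  let : MeasurableSpace (Ta α V r) := borel _
  have : BorelSpace (Ta α V r) := ⟨rfl⟩
  have : SecondCountableTopology (Ta α V r) := UniformSpace.secondCountable_of_separable _
  rw [← BorelSpace.measurable_eq (α := Fin (T r + 1) → Ta α V r)]
  exact measurable_pi_lambda _ fun t => h.1.comp (measurable_pi_apply t)

theorem ESigMGenerates.pi_le {r : ℕ} (h : ESigMGenerates T Λ r) :
    (inferInstance : MeasurableSpace (Fin (T r + 1) → MeasSp T V r)) ≤
      (borel (Fin (T r + 1) → Ta α V r)).comap fun x t => robustESigM Λ T r (x t) := by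
  let : MeasurableSpace (Ta α V r) := borel _
  have : BorelSpace (Ta α V r) := ⟨rfl⟩
  have : SecondCountableTopology (Ta α V r) := UniformSpace.secondCountable_of_separable _
  rw [← BorelSpace.measurable_eq (α := Fin (T r + 1) → Ta α V r)]
  exact pi_le_comap h.2

theorem ESigMGenerates.stronglyMeasurable {r : ℕ} (h : ESigMGenerates T Λ r)
    (hΛ : ∀ r, IsTensorNormalization α (Λ r)) :
    StronglyMeasurable fun x : Fin (T r + 1) → MeasSp T V r =>
      liftSig Λ (robustESigM Λ T r) x := by
  let : MeasurableSpace (Fin (T r + 1) → Ta α V r) := borel _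
  have : BorelSpace (Fin (T r + 1) → Ta α V r) := ⟨rfl⟩
  have : SecondCountableTopology (TA α (Ta α V r)) := UniformSpace.secondCountable_of_separable _
  exact ((hΛ r).continuous_comp_sig (T r)).stronglyMeasurable.comp_measurable h.measurable_pi

/-- The same argument with the Jordan parts as the two measures; their difference is the evaluation
of `μ`. -/
theorem ESigMGenerates.measurable_apply [CompleteSpace V] {r : ℕ} (h : ESigMGenerates T Λ r)
    (hΛ : ∀ r, IsTensorNormalization α (Λ r)) {B : Set (Fin (T r + 1) → MeasSp T V r)}
    (hB : MeasurableSet B) :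
    Measurable[(borel (Ta α V (r + 1))).comap (robustESigM Λ T (r + 1))]
      fun μ : SignedMeasure (Fin (T r + 1) → MeasSp T V r) => μ B := by
  have key := @IsTensorNormalization.measurable_real_sub_real _ _ _ _ _ _ _ (hΛ r) (T r)
    (Fin (T r + 1) → MeasSp T V r) _ (fun x t => robustESigM Λ T r (x t)) h.measurable_pi h.pi_le
    (SignedMeasure (Fin (T r + 1) → MeasSp T V r))
    ((borel (Ta α V (r + 1))).comap (robustESigM Λ T (r + 1)))
    (fun μ => μ.toJordanDecomposition.posPart) (fun μ => μ.toJordanDecomposition.negPart) _ _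
    (comap_measurable (m := borel (Ta α V (r + 1))) (robustESigM Λ T (r + 1))) B hB
  simp only [← SignedMeasure.apply_eq_posPart_real_sub_negPart_real _ hB] at key
  exact key

theorem eSigMGenerates [CompleteSpace V] (hΛ : ∀ r, IsTensorNormalization α (Λ r)) (r : ℕ) :
    ESigMGenerates T Λ r := by
  induction r with
  | zero => exact ⟨measurable_id, MeasurableSpace.comap_id.ge⟩
  | succ r ih =>
    obtain ⟨K, hK⟩ := exists_norm_liftSig_le hΛ r
    refine ⟨?_, ?_⟩
    · let : MeasurableSpace (Ta α V (r + 1)) := borel _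
      have : BorelSpace (Ta α V (r + 1)) := ⟨rfl⟩
      have : SecondCountableTopology (Ta α V (r + 1)) :=
        UniformSpace.secondCountable_of_separable _
      exact measurable_signedIntegral (ih.stronglyMeasurable hΛ) (C := K) fun x => hK _ x
    · refine iSup₂_le fun B hB => ?_
      rw [← BorelSpace.measurable_eq (α := ℝ)]
      exact (ih.measurable_apply hΛ hB).comap_le

theorem integrable_liftSig_totalVariation [CompleteSpace V]
    (hΛ : ∀ r, IsTensorNormalization α (Λ r)) (r : ℕ)
    (μ : SignedMeasure (Fin (T r + 1) → MeasSp T V r)) :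
    Integrable (liftSig Λ (robustESigM Λ T r)) μ.totalVariation := by
  obtain ⟨K, hK⟩ := exists_norm_liftSig_le hΛ r
  exact integrable_of_stronglyMeasurable_bdd ((eSigMGenerates hΛ r).stronglyMeasurable hΛ)
    (fun x => hK _ x) _

theorem injective_robustESigM [CompleteSpace V] (hΛ : ∀ r, IsTensorNormalization α (Λ r)) (r : ℕ) :
    Function.Injective (robustESigM Λ T (r + 1)) := by
  intro μ ν h
  exact VectorMeasure.ext fun B hB =>
    eq_of_measurable_comap (mZ := borel (Ta α V (r + 1)))
      ((eSigMGenerates hΛ r).measurable_apply hΛ hB) h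

end SignedMeasures

theorem exists_bounded_continuous_injective (V : Type*) [NormedAddCommGroup V] [NormedSpace ℝ V] :
    ∃ f : V → V, (∃ C : ℝ, ∀ x, ‖f x‖ ≤ C) ∧ Continuous f ∧ Function.Injective f := by
  have hpos : ∀ x : V, 0 < 1 + ‖x‖ := fun x => by positivity
  have hn : ∀ x : V, ‖(1 + ‖x‖)⁻¹ • x‖ = 1 - (1 + ‖x‖)⁻¹ := fun x => by
    rw [norm_smul, Real.norm_of_nonneg (inv_nonneg.mpr (hpos x).le)]
    field_simp [(hpos x).ne']
    ring
  -- Radial compression onto the open unit ball: the norm of the image determines the scaling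
  -- factor, which can then be cancelled.
  refine ⟨fun x => (1 + ‖x‖)⁻¹ • x, ⟨1, fun x => ?_⟩, ?_, fun x y h => ?_⟩
  · rw [hn]
    linarith [inv_pos.mpr (hpos x)]
  · exact ((continuous_const.add continuous_norm).inv₀ fun x => (hpos x).ne').smul continuous_id
  · have h : (1 + ‖x‖)⁻¹ • x = (1 + ‖y‖)⁻¹ • y := h
    have h1 := hn x
    rw [h, hn y] at h1
    have h2 : (1 + ‖y‖)⁻¹ = (1 + ‖x‖)⁻¹ := by linarith
    rw [h2] at h
    exact smul_right_injective V (inv_pos.mpr (hpos x)).ne' h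

end HRSig

theorem proposition3p7 (α : AdmissibleNorm.{u}) (V : Type u) [NormedAddCommGroup V]
    [NormedSpace ℝ V] [CompleteSpace V] [TopologicalSpace.SeparableSpace V] (T : ℕ → ℕ) :
    -- all higher rank tensor algebras are separable Banach spaces
    (∀ r : ℕ, CompleteSpace (Ta α V r) ∧ TopologicalSpace.SeparableSpace (Ta α V r)) ∧
    -- in rank zero all the spaces are `V`
    (∃ f : V → V, (∃ C : ℝ, ∀ x, ‖f x‖ ≤ C) ∧ Continuous f ∧ Function.Injective f) ∧
    -- tensor normalizations exist on all ranks
    (∃ Λ : ∀ r : ℕ, TA α (Ta α V r) → TA α (Ta α V r), ∀ r, IsTensorNormalization α (Λ r)) ∧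
    -- and for any choice of them the robust maps of all ranks have the asserted properties
    (∀ Λ : ∀ r : ℕ, TA α (Ta α V r) → TA α (Ta α V r), (∀ r, IsTensorNormalization α (Λ r)) →
      ∀ r : ℕ,
        -- the robust signature map
        ((∃ C : ℝ, ∀ x : PathSp T V (r + 1), ‖robustSig Λ T (r + 1) x‖ ≤ C) ∧
          Continuous (robustSig Λ T (r + 1)) ∧
          Function.Injective (robustSig Λ T (r + 1))) ∧
        -- the robust expected signature map on probability measures
        ((∀ μ : BorelProb (Fin (T r + 1) → ProbSp T V r),
            @MeasureTheory.Integrable _ _ _ _ (borel _) (liftSig Λ (robustESig Λ T r))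
              μ.toMeasure) ∧
          (∃ C : ℝ, ∀ μ : ProbSp T V (r + 1), ‖robustESig Λ T (r + 1) μ‖ ≤ C) ∧
          Continuous (robustESig Λ T (r + 1)) ∧
          Function.Injective (robustESig Λ T (r + 1))) ∧
        -- the robust expected signature map on signed measures
        ((∀ μ : MeasureTheory.SignedMeasure (Fin (T r + 1) → MeasSp T V r),
            MeasureTheory.Integrable (liftSig Λ (robustESigM Λ T r)) μ.totalVariation) ∧
          (∃ C : ℝ, ∀ μ : MeasureTheory.SignedMeasure (Fin (T r + 1) → MeasSp T V r),
            ‖robustESigM Λ T (r + 1) μ‖ ≤ C * μ.totalVariation.real Set.univ) ∧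
          Function.Injective (robustESigM Λ T (r + 1)))) := by
  refine ⟨fun r => ⟨completeSpace_Ta α V r, separableSpace_Ta α V r⟩,
    exists_bounded_continuous_injective V,
    ⟨fun r => tensorNormalization, fun r => isTensorNormalization_tensorNormalization α _⟩,
    fun Λ hΛ r => ?_⟩
  obtain ⟨K, hK⟩ := exists_norm_liftSig_le hΛ r
  exact ⟨⟨⟨K, fun x => hK (robustSig Λ T r) x⟩, continuous_robustSig T hΛ (r + 1),
      injective_robustSig T hΛ (r + 1)⟩,
    ⟨(eSigGenerates hΛ r).integrable hΛ, norm_robustESig_le T hΛ r,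
      (eSigGenerates hΛ (r + 1)).1, injective_robustESig hΛ r⟩,
    ⟨integrable_liftSig_totalVariation hΛ r,
      ⟨K, fun μ => norm_signedIntegral_le (fun x => hK _ x) μ⟩, injective_robustESigM hΛ r⟩⟩
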